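/- Let $\mathbb{Z}^+=\{0,1,2,\dots\}$ and, for $n\ge 1$, let $P_n$ be the orthogonal projection of $l^2(\mathbb{Z}^+)$ onto the span of the first $n$ standard basis vectors. Let $AP(\mathbb{Z})$ be the set of all $b\in l^\infty(\mathbb{Z})$ whose set of translates is relatively compact in $l^\infty(\mathbb{Z})$. For $a\in L^\infty(\mathbb{T})$ with Fourier coefficients $a_k$, let $T(a)$ be the Toeplitz operator on $l^2(\mathbb{Z}^+)$ with matrix $(a_{i-j})_{i,j\ge 0}$. Let $\mathcal{A}$ be the smallest closed $C^*$-subalgebra of $L(l^2(\mathbb{Z}^+))$ which contains all $T(a)$ with $a\in L^\infty(\mathbb{T})$ and all operators of multiplication by $b|_{\mathbb{Z}^+}$ with $b\in AP(\mathbb{Z})$. Let $\mathcal{F}$ be the $C^*$-algebra (entrywise operations, supremum norm) of all sequences $\mathbf{A}=(A_n)_{n\ge 1}$ of operators $A_n$ on $\operatorname{im}P_n$ for which $A_nP_n$ and $A_n^*P_n$ converge strongly on $l^2(\mathbb{Z}^+)$, let $W(\mathbf{A})$ be the strong limit of $A_nP_n$, and let $\mathcal{G}$ be the ideal of all $(G_n)\in\mathcal{F}$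 with $\|G_n\|\to 0$. The stability spectrum of $\mathbf{A}\in\mathcal{F}$ is the spectrum of the coset $\mathbf{A}+\mathcal{G}$ in $\mathcal{F}/\mathcal{G}$. Let $\mathcal{S}=\mathcal{S}_{L^\infty(\mathbb{T}),AP(\mathbb{Z})}(\mathbb{Z}^+)$ be the smallest closed $C^*$-subalgebra of $\mathcal{F}$ which contains all sequences $(P_nAP_n)$ with $A\in\mathcal{A}$. For an operator $A$ on $l^2(\mathbb{Z}^+)$ with matrix $(a_{ij})$, let $D_{ap}(A)$ be the (unique, if it exists) function $f\in AP(\mathbb{Z})$ with $a_{nn}-f(n)\to 0$ as $n\to+\infty$. For $f\in AP(\mathbb{Z})$ put $M(f)=\lim_{n\to\infty}\frac1n\sum_{r=0}^{n-1}f(r)$. **Theorem.** Let $\mathbf{A}=(A_n)\in\mathcal{S}$, let $\mathbf{B}=(\mathbf{A}^*\mathbf{A})^{1/2}\in\mathcal{F}$, and let $g$ be a complex-valued function which is continuous on an open set $U\subseteq\mathbb{R}$ that contains the stability spectrum of $\mathbf{B}$. Then $W(\mathbf{B})$ is self-adjoint with spectrum in $U$, the operator $g(W(\mathbf{B}))$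 belongs to $\mathcal{A}$, its almost periodic part $D_{ap}(g(W(\mathbf{B})))$ and the mean value of the latter exist, and $$\lim_{n\to\infty}\frac{g(\sigma_1(A_n))+\dots+g(\sigma_n(A_n))}{n}=M\big(D_{ap}(g(W(\mathbf{B})))\big),$$ where $\sigma_1(A_n),\dots,\sigma_n(A_n)$ are the singular values of $A_n$, counted with multiplicity. (The finitely many $n$ for which some $\sigma_j(A_n)$ may lie outside $U$ do not matter; extend $g$ arbitrarily there.) -/

import Mathlib

open Filter Topology MeasureTheory
open scoped ENNReal BoundedContinuousFunction

noncomputable section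

namespace SzegoAP

/-! ### Spaces, restrictions and multiplication operators -/

/-- The Hilbert space `l²(ℤ)`. -/
abbrev L2Z : Type := lp (fun _ : ℤ => ℂ) 2

/-- The Hilbert space `l²(ℤ⁺)`, where `ℤ⁺ = {0, 1, 2, …}`. -/
abbrev L2N : Type := lp (fun _ : ℕ => ℂ) 2

/-- The range of the projection `P_n`, i.e. `ℂⁿ` with the Euclidean norm. -/
abbrev ImP (n : ℕ) : Type := EuclideanSpace ℂ (Fin n)

/-- An injective reindexing does not increase the `l²`-norm. -/
theorem memlp_comp {ι κ : Type} {e : κ → ι} (he : Function.Injective e)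
    (x : lp (fun _ : ι => ℂ) 2) : Memℓp (fun k : κ => x (e k)) 2 := by
  have h := (lp.memℓp x).summable (by norm_num)
  exact memℓp_gen (h.comp_injective he)

theorem norm_comp_le {ι κ : Type} {e : κ → ι} (he : Function.Injective e)
    (x : lp (fun _ : ι => ℂ) 2) :
    ‖(⟨fun k : κ => x (e k), memlp_comp he x⟩ : lp (fun _ : κ => ℂ) 2)‖ ≤ ‖x‖ := by
  refine lp.norm_le_of_tsum_le (by norm_num) (norm_nonneg _) ?_
  rw [lp.norm_rpow_eq_tsum (by norm_num) x]
  have h := (lp.memℓp x).summable (by norm_num)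
  exact (h.comp_injective he).tsum_le_tsum_of_inj e he (fun _ _ => by positivity)
    (fun _ => le_rfl) h

/-- The operator `l²(ι) → l²(κ)`, `x ↦ x ∘ e`, for an injective map `e : κ → ι`. -/
def pullback {ι κ : Type} {e : κ → ι} (he : Function.Injective e) :
    lp (fun _ : ι => ℂ) 2 →L[ℂ] lp (fun _ : κ => ℂ) 2 :=
  LinearMap.mkContinuous
    { toFun := fun x => ⟨fun k => x (e k), memlp_comp he x⟩
      map_add' := fun _ _ => rfl
      map_smul' := fun _ _ => rfl } 1
    (fun x => (norm_comp_le he x).trans_eq (one_mul _).symm)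

/-- The restriction operator `l²(ℤ) → l²(ℤ⁺)`; its adjoint is extension by zero. -/
def restrictZ : L2Z →L[ℂ] L2N :=
  pullback (e := fun n : ℕ => (n : ℤ)) Nat.cast_injective

theorem norm_first_le (n : ℕ) (x : L2N) :
    ‖(WithLp.toLp 2 (fun i : Fin n => x (i : ℕ)) : ImP n)‖ ≤ ‖x‖ := by
  have h := norm_comp_le (Fin.val_injective (n := n)) x
  refine le_trans (le_of_eq ?_) h
  rw [EuclideanSpace.norm_eq, lp.norm_eq_tsum_rpow (by norm_num), tsum_fintype, Real.sqrt_eq_rpow]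
  norm_num

/-- `P_n` regarded as an operator `l²(ℤ⁺) → im P_n`: it keeps the entries `0, …, n - 1`. -/
def firstEntries (n : ℕ) : L2N →L[ℂ] ImP n :=
  LinearMap.mkContinuous
    { toFun := fun x => WithLp.toLp 2 (fun i : Fin n => x (i : ℕ))
      map_add' := fun _ _ => rfl
      map_smul' := fun _ _ => rfl } 1
    (fun x => (norm_first_le n x).trans_eq (one_mul _).symm)

/-- The inclusion `im P_n → l²(ℤ⁺)` (extension by zero). -/
def inclusion (n : ℕ) : ImP n →L[ℂ] L2N := (firstEntries n).adjoint

theorem inclusion_apply (n : ℕ) (v : ImP n) (k : ℕ) :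
    inclusion n v k = if h : k < n then v ⟨k, h⟩ else 0 := by
  have h1 : inclusion n v k = inner ℂ (lp.single 2 k (1 : ℂ)) (inclusion n v) := by
    rw [lp.inner_single_left]; simp
  rw [h1, inclusion, ContinuousLinearMap.adjoint_inner_right, PiLp.inner_apply]
  have h2 : ∀ i : Fin n, firstEntries n (lp.single 2 k (1 : ℂ)) i
      = (lp.single 2 k (1 : ℂ) : L2N) (i : ℕ) := fun _ => rfl
  simp only [h2, lp.single_apply]
  split_ifs with h
  · rw [Finset.sum_eq_single ⟨k, h⟩]
    · simp
    · intro i _ hi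
      have : (i : ℕ) ≠ k := fun hk => hi (Fin.ext hk)
      simp [this]
    · simp
  · refine Finset.sum_eq_zero fun i _ => ?_
    have : (i : ℕ) ≠ k := fun hk => h (hk ▸ i.2)
    simp [this]

theorem firstEntries_inclusion (n : ℕ) (v : ImP n) : firstEntries n (inclusion n v) = v := by
  ext i
  have h : firstEntries n (inclusion n v) i = inclusion n v (i : ℕ) := rfl
  rw [h, inclusion_apply, dif_pos i.2]

theorem inclusion_firstEntries (n : ℕ) (x : L2N) :
    inclusion n (firstEntries n x) = ∑ k ∈ Finset.range n, lp.single 2 k (x k) := by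
  ext m
  rw [inclusion_apply, lp.coeFn_sum, Finset.sum_apply]
  simp only [lp.single_apply]
  split_ifs with h
  · rw [Finset.sum_eq_single m]
    · simp; rfl
    · intro b _ hb
      simp [hb.symm]
    · simp [h]
  · symm
    refine Finset.sum_eq_zero fun b hb => ?_
    have : m ≠ b := fun hk => h (hk ▸ Finset.mem_range.1 hb)
    simp [this]

theorem norm_firstEntries_le (n : ℕ) : ‖firstEntries n‖ ≤ 1 :=
  LinearMap.mkContinuous_norm_le _ zero_le_one _

theorem norm_inclusion_le (n : ℕ) : ‖inclusion n‖ ≤ 1 := by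
  rw [inclusion, LinearIsometryEquiv.norm_map]
  exact norm_firstEntries_le n

/-- `P_n → I` strongly. -/
theorem tendsto_proj (x : L2N) :
    Tendsto (fun n => inclusion (n + 1) (firstEntries (n + 1) x)) atTop (𝓝 x) := by
  have h := (lp.hasSum_single (by norm_num : (2 : ℝ≥0∞) ≠ ∞) x).tendsto_sum_nat
  simp only [inclusion_firstEntries]
  exact h.comp (tendsto_add_atTop_nat 1)

/-- `A_n P_n` as an operator on `l²(ℤ⁺)`. -/
def extendOp {n : ℕ} (T : ImP n →L[ℂ] ImP n) : L2N →L[ℂ] L2N :=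
  inclusion n ∘L T ∘L firstEntries n

theorem norm_extendOp_le {n : ℕ} (T : ImP n →L[ℂ] ImP n) : ‖extendOp T‖ ≤ ‖T‖ := by
  refine (ContinuousLinearMap.opNorm_comp_le _ _).trans ?_
  have h := ContinuousLinearMap.opNorm_comp_le T (firstEntries n)
  have h1 := norm_firstEntries_le n
  have h2 := norm_inclusion_le n
  have h3 : ‖T ∘L firstEntries n‖ ≤ ‖T‖ := h.trans (mul_le_of_le_one_right (norm_nonneg _) h1)
  exact (mul_le_of_le_one_left (norm_nonneg _) h2).trans h3

/-- The operator of multiplication by the restriction of `b ∈ l^∞(ℤ)` to `ℤ⁺`, i.e. `P b P`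
on `l²(ℤ⁺)`. -/
def mulOp (b : ℤ →ᵇ ℂ) : L2N →L[ℂ] L2N :=
  LinearMap.mkContinuous
    { toFun := fun x => ⟨fun n => b n * x n,
        (memℓp_gen (by
          have h := ((lp.memℓp x).summable (by norm_num)).mul_left (‖b‖ ^ (2 : ℝ≥0∞).toReal)
          refine h.of_nonneg_of_le (fun _ => by positivity) fun n => ?_
          rw [norm_mul, Real.mul_rpow (norm_nonneg _) (norm_nonneg _)]
          gcongr
          exact b.norm_coe_le_norm n) : Memℓp (fun n : ℕ => b n * x n) 2)⟩
      map_add' := fun x y => lp.ext (funext fun n => mul_add (b n) (x n) (y n))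
      map_smul' := fun c x => lp.ext (funext fun n => mul_left_comm (b n) c (x n)) } ‖b‖
    (fun x => by
      refine lp.norm_le_of_tsum_le (by norm_num) (by positivity) ?_
      have h := (lp.memℓp x).summable (by norm_num)
      rw [Real.mul_rpow (norm_nonneg _) (norm_nonneg _), lp.norm_rpow_eq_tsum (by norm_num) x,
        ← tsum_mul_left]
      have hle : ∀ n : ℕ, ‖b n * x n‖ ^ (2 : ℝ≥0∞).toReal
          ≤ ‖b‖ ^ (2 : ℝ≥0∞).toReal * ‖x n‖ ^ (2 : ℝ≥0∞).toReal := fun n => by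
        rw [norm_mul, Real.mul_rpow (norm_nonneg _) (norm_nonneg _)]
        gcongr
        exact b.norm_coe_le_norm n
      exact Summable.tsum_le_tsum hle
        ((h.mul_left _).of_nonneg_of_le (fun _ => by positivity) hle) (h.mul_left _))

/-! ### Laurent and Toeplitz operators -/

instance fact_two_pi_pos : Fact (0 < 2 * Real.pi) := ⟨Real.two_pi_pos⟩

/-- The unit circle `𝕋`, parametrised by `t ∈ ℝ / 2πℤ` through `t ↦ e^{it}`. -/
abbrev Circ : Type := AddCircle (2 * Real.pi)

/-- Normalised Lebesgue measure `dt / 2π` on the unit circle. -/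
abbrev circMeasure : Measure Circ := AddCircle.haarAddCircle

/-- The operator of multiplication by `a ∈ L^∞(𝕋)` on `L²(𝕋)`. -/
def circMul (a : Lp ℂ ∞ circMeasure) : Lp ℂ 2 circMeasure →L[ℂ] Lp ℂ 2 circMeasure :=
  (ContinuousLinearMap.mul ℂ ℂ).holderL circMeasure ∞ 2 2 a

/-- The Laurent operator `L(a)` on `l²(ℤ)`: multiplication by `a`, transported to `l²(ℤ)` through
the Fourier coefficients.  Its matrix is `(a_{i-j})`, see `laurent_entry`. -/
def laurent (a : Lp ℂ ∞ circMeasure) : L2Z →L[ℂ] L2Z :=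
  (fourierBasis (T := 2 * Real.pi)).repr.toContinuousLinearEquiv.toContinuousLinearMap ∘L
    circMul a ∘L
    (fourierBasis (T := 2 * Real.pi)).repr.symm.toContinuousLinearEquiv.toContinuousLinearMap

theorem circMul_coe (a : Lp ℂ ∞ circMeasure) (f : Lp ℂ 2 circMeasure) :
    circMul a f =ᵐ[circMeasure] fun t => a t * f t := by
  have := ContinuousLinearMap.coeFn_holder (r := 2) (ContinuousLinearMap.mul ℂ ℂ) a f
  simpa [circMul] using this

/-- The matrix of `L(a)` is `(a_{i-j})`, where `a_k` is the `k`th Fourier coefficient of `a`. -/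
theorem laurent_entry (a : Lp ℂ ∞ circMeasure) (i j : ℤ) :
    laurent a (lp.single 2 j (1 : ℂ)) i = fourierCoeff (a : Circ → ℂ) (i - j) := by
  have h1 : laurent a (lp.single 2 j (1 : ℂ)) i
      = fourierBasis.repr (circMul a (fourierBasis.repr.symm (lp.single 2 j (1 : ℂ)))) i := rfl
  rw [h1, fourierBasis_repr, HilbertBasis.repr_symm_single, coe_fourierBasis]
  unfold fourierCoeff
  refine integral_congr_ae ?_
  filter_upwards [circMul_coe a (fourierLp 2 j), coeFn_fourierLp (T := 2 * Real.pi) 2 j]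
    with t h2 h3
  rw [h2, h3, show -(i - j) = -i + j by ring, fourier_add]
  simp only [smul_eq_mul]
  ring

/-- The Toeplitz operator `T(a) = P L(a) P` on `l²(ℤ⁺)`.  Its matrix is `(a_{i-j})`, see
`toeplitz_entry`. -/
def toeplitz (a : Lp ℂ ∞ circMeasure) : L2N →L[ℂ] L2N :=
  restrictZ ∘L laurent a ∘L restrictZ.adjoint

theorem toeplitz_entry (a : Lp ℂ ∞ circMeasure) (i j : ℕ) :
    toeplitz a (lp.single 2 j (1 : ℂ)) i = fourierCoeff (a : Circ → ℂ) ((i : ℤ) - j) := by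
  have h : restrictZ.adjoint (lp.single 2 j (1 : ℂ)) = lp.single 2 (j : ℤ) (1 : ℂ) := by
    refine ext_inner_right ℂ fun v => ?_
    rw [ContinuousLinearMap.adjoint_inner_left, lp.inner_single_left, lp.inner_single_left]
    rfl
  rw [← laurent_entry, ← h]
  rfl

/-! ### Almost periodic functions and the operator algebra -/

/-- The translate `n ↦ a (n + k)` of a bounded function on `ℤ`. -/
def translate (k : ℤ) (a : ℤ →ᵇ ℂ) : ℤ →ᵇ ℂ :=
  a.compContinuous ⟨fun n => n + k, continuous_of_discreteTopology⟩

/-- `a ∈ AP(ℤ)`: the set of all translates of `a` is relatively compact in `l^∞(ℤ)`. -/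
def IsAP (a : ℤ →ᵇ ℂ) : Prop :=
  IsCompact (closure (Set.range fun k : ℤ => translate k a))

/-- The algebra `𝒜_{L^∞(𝕋), AP(ℤ)}(ℤ⁺)`: the smallest closed `C*`-subalgebra of `L(l²(ℤ⁺))` which
contains all Toeplitz operators `T(a)`, `a ∈ L^∞(𝕋)`, and all operators `P b P`, `b ∈ AP(ℤ)`.
It contains the identity operator, which is `T(1)`. -/
def opAlg : StarSubalgebra ℂ (L2N →L[ℂ] L2N) :=
  (StarAlgebra.adjoin ℂ
    (Set.range toeplitz ∪ {T | ∃ b : ℤ →ᵇ ℂ, IsAP b ∧ T = mulOp b})).topologicalClosure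

/-! ### The algebra of strongly convergent sequences -/

/-- A uniformly bounded product of `C*`-algebras is a `C*`-algebra. -/
abbrev lpCStar {I : Type} {A : I → Type} [∀ i, Nontrivial (A i)] [∀ i, CStarAlgebra (A i)] :
    CStarAlgebra (lp A ∞) where

/-- The bounded sequences of operators `A_n` on `im P_n`, `n ≥ 1`, with the supremum norm.  The
entry with index `n` is the operator on `im P_{n+1}`. -/
def BddSeq : Type := lp (fun n : ℕ => ImP (n + 1) →L[ℂ] ImP (n + 1)) ∞

namespace BddSeq

instance : CoeFun BddSeq fun _ => (n : ℕ) → ImP (n + 1) →L[ℂ] ImP (n + 1) :=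
  ⟨fun A => A.1⟩

/-- With the entrywise operations and the supremum norm, the bounded sequences form a
`C*`-algebra.  (A plain definition, so that instance search does not unfold it.) -/
def cStarAlgebra : CStarAlgebra BddSeq :=
  lpCStar (I := ℕ) (A := fun n : ℕ => ImP (n + 1) →L[ℂ] ImP (n + 1))

instance instCStarAlgebra : CStarAlgebra BddSeq := cStarAlgebra

theorem ext {A B : BddSeq} (h : ∀ n, A n = B n) : A = B := Subtype.ext (funext h)

theorem add_apply (A B : BddSeq) (n : ℕ) : (A + B) n = A n + B n := rfl

theorem sub_apply (A B : BddSeq) (n : ℕ) : (A - B) n = A n - B n := rfl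

theorem zero_apply (n : ℕ) : (0 : BddSeq) n = 0 := rfl

theorem mul_apply (A B : BddSeq) (n : ℕ) : (A * B) n = A n * B n := rfl

theorem star_apply (A : BddSeq) (n : ℕ) : (star A) n = star (A n) := rfl

theorem algebraMap_apply (c : ℂ) (n : ℕ) :
    (algebraMap ℂ BddSeq c) n = algebraMap ℂ (ImP (n + 1) →L[ℂ] ImP (n + 1)) c := rfl

theorem norm_apply_le (A : BddSeq) (n : ℕ) : ‖A n‖ ≤ ‖A‖ :=
  lp.norm_apply_le_norm ENNReal.top_ne_zero
    (A : lp (fun n : ℕ => ImP (n + 1) →L[ℂ] ImP (n + 1)) ∞) n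

/-- The norm is the supremum norm. -/
theorem norm_eq_iSup (A : BddSeq) : ‖A‖ = ⨆ n, ‖A n‖ :=
  lp.norm_eq_ciSup (A : lp (fun n : ℕ => ImP (n + 1) →L[ℂ] ImP (n + 1)) ∞)

/-- The bounded sequence with given entries. -/
def of (A : (n : ℕ) → ImP (n + 1) →L[ℂ] ImP (n + 1)) (C : ℝ) (hC : ∀ n, ‖A n‖ ≤ C) : BddSeq :=
  ⟨A, memℓp_infty ⟨C, by rintro _ ⟨n, rfl⟩; exact hC n⟩⟩

end BddSeq

theorem extendOp_add {n : ℕ} (S T : ImP n →L[ℂ] ImP n) :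
    extendOp (S + T) = extendOp S + extendOp T := by
  ext1 x; simp [extendOp]

theorem extendOp_sub {n : ℕ} (S T : ImP n →L[ℂ] ImP n) :
    extendOp (S - T) = extendOp S - extendOp T := by
  ext1 x; simp [extendOp]

theorem extendOp_mul {n : ℕ} (S T : ImP n →L[ℂ] ImP n) :
    extendOp (S * T) = extendOp S * extendOp T := by
  ext1 x; simp [extendOp, firstEntries_inclusion]

theorem extendOp_algebraMap (n : ℕ) (c : ℂ) (x : L2N) :
    extendOp (algebraMap ℂ (ImP n →L[ℂ] ImP n) c) x = c • inclusion n (firstEntries n x) := by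
  simp [extendOp, Algebra.algebraMap_eq_smul_one]

/-- `A_n P_n → T` strongly on `l²(ℤ⁺)`. -/
def IsStrongLimit (A : BddSeq) (T : L2N →L[ℂ] L2N) : Prop :=
  ∀ x : L2N, Tendsto (fun n => extendOp (A n) x) atTop (𝓝 (T x))

theorem IsStrongLimit.mul {A B : BddSeq} {S T : L2N →L[ℂ] L2N}
    (hA : IsStrongLimit A S) (hB : IsStrongLimit B T) : IsStrongLimit (A * B) (S * T) := by
  intro x
  have h1 : ∀ n, extendOp ((A * B) n) x = extendOp (A n) (T x)
      + extendOp (A n) (extendOp (B n) x - T x) := by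
    intro n
    rw [map_sub, BddSeq.mul_apply, extendOp_mul, mul_apply_eq_comp]
    abel
  simp only [h1]
  have h2 : Tendsto (fun n => extendOp (A n) (extendOp (B n) x - T x)) atTop (𝓝 0) := by
    have h3 := (tendsto_iff_norm_sub_tendsto_zero.1 (hB x)).const_mul ‖A‖
    rw [mul_zero] at h3
    refine squeeze_zero_norm (fun n => ?_) h3
    refine (ContinuousLinearMap.le_opNorm _ _).trans ?_
    gcongr
    exact (norm_extendOp_le _).trans (A.norm_apply_le n)
  simpa using (hA (T x)).add h2

theorem IsStrongLimit.add {A B : BddSeq} {S T : L2N →L[ℂ] L2N}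
    (hA : IsStrongLimit A S) (hB : IsStrongLimit B T) : IsStrongLimit (A + B) (S + T) := by
  intro x
  refine ((hA x).add (hB x)).congr fun n => ?_
  rw [BddSeq.add_apply, extendOp_add, _root_.add_apply]

theorem isStrongLimit_algebraMap (c : ℂ) :
    IsStrongLimit (algebraMap ℂ BddSeq c) (algebraMap ℂ (L2N →L[ℂ] L2N) c) := by
  intro x
  have h : algebraMap ℂ (L2N →L[ℂ] L2N) c x = c • x := by
    simp [Algebra.algebraMap_eq_smul_one]
  rw [h]
  refine ((tendsto_proj x).const_smul c).congr fun n => ?_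
  rw [BddSeq.algebraMap_apply, extendOp_algebraMap]

/-- Uniform limits of strongly convergent sequences are strongly convergent. -/
theorem exists_isStrongLimit_of_closure {K : Set BddSeq}
    (hK : ∀ B ∈ K, ∃ T, IsStrongLimit B T) {A : BddSeq} (hA : A ∈ closure K) :
    ∃ T, IsStrongLimit A T := by
  have hc : ∀ x : L2N, ∃ y, Tendsto (fun n => extendOp (A n) x) atTop (𝓝 y) := by
    intro x
    refine cauchySeq_tendsto_of_complete (Metric.cauchySeq_iff'.2 fun ε hε => ?_)
    obtain ⟨B, hB, hAB⟩ := Metric.mem_closure_iff.1 hA (ε / 3 / (‖x‖ + 1)) (by positivity)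
    obtain ⟨T, hT⟩ := hK B hB
    obtain ⟨N, hN⟩ := Metric.cauchySeq_iff'.1 (hT x).cauchySeq (ε / 3) (by positivity)
    have hd : ∀ n, dist (extendOp (A n) x) (extendOp (B n) x) < ε / 3 := by
      intro n
      have h1 : extendOp (A n) x - extendOp (B n) x = extendOp ((A - B) n) x := by
        rw [BddSeq.sub_apply, extendOp_sub, _root_.sub_apply]
      rw [dist_eq_norm, h1]
      have h2 : ‖extendOp ((A - B) n)‖ ≤ ‖A - B‖ :=
        (norm_extendOp_le _).trans ((A - B).norm_apply_le n)
      have h3 := (extendOp ((A - B) n)).le_of_opNorm_le h2 x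
      rw [dist_eq_norm, lt_div_iff₀ (by positivity)] at hAB
      nlinarith [norm_nonneg (A - B)]
    refine ⟨N, fun n hn => ?_⟩
    calc dist (extendOp (A n) x) (extendOp (A N) x)
        ≤ dist (extendOp (A n) x) (extendOp (B n) x) + dist (extendOp (B n) x) (extendOp (B N) x)
          + dist (extendOp (B N) x) (extendOp (A N) x) := dist_triangle4 _ _ _ _
      _ < ε / 3 + ε / 3 + ε / 3 := by
          have := hd N
          rw [dist_comm] at this
          exact add_lt_add (add_lt_add (hd n) (hN n hn)) this
      _ = ε := by ring
  choose f hf using hc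
  exact ⟨continuousLinearMapOfTendsto (fun n => extendOp (A n)) (f := f) (l := atTop)
    (tendsto_pi_nhds.2 hf), hf⟩

/-- The algebra `𝓕^𝒫` of all sequences `(A_n)` of operators on `im P_n` for which the strong limits
of `A_n P_n` and of `A_n^* P_n` exist (such sequences are automatically bounded). -/
def seqAlg : StarSubalgebra ℂ BddSeq where
  carrier := {A | (∃ T, IsStrongLimit A T) ∧ ∃ T, IsStrongLimit (star A) T}
  mul_mem' := by
    rintro A B ⟨⟨S, hS⟩, S', hS'⟩ ⟨⟨T, hT⟩, T', hT'⟩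
    exact ⟨⟨_, hS.mul hT⟩, _, by rw [star_mul]; exact hT'.mul hS'⟩
  add_mem' := by
    rintro A B ⟨⟨S, hS⟩, S', hS'⟩ ⟨⟨T, hT⟩, T', hT'⟩
    exact ⟨⟨_, hS.add hT⟩, _, by rw [star_add]; exact hS'.add hT'⟩
  algebraMap_mem' c := ⟨⟨_, isStrongLimit_algebraMap c⟩, _, by
    rw [← algebraMap_star_comm]; exact isStrongLimit_algebraMap _⟩
  star_mem' := by
    rintro A ⟨h1, h2⟩
    exact ⟨h2, by rwa [star_star]⟩

instance isClosed_seqAlg : IsClosed (seqAlg : Set BddSeq) := by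
  refine isClosed_of_closure_subset fun A hA => ⟨?_, ?_⟩
  · exact exists_isStrongLimit_of_closure (fun B hB => hB.1) hA
  · refine exists_isStrongLimit_of_closure (K := (seqAlg : Set BddSeq)) (fun B hB => hB.1) ?_
    exact map_mem_closure continuous_star hA fun B hB => star_mem hB

instance seqAlgCStar : CStarAlgebra seqAlg :=
  StarSubalgebra.cstarAlgebra (S := StarSubalgebra ℂ BddSeq) seqAlg (h_closed := isClosed_seqAlg)

/-- The closed ideal `𝓖` of all sequences `(G_n)` in `𝓕^𝒫` with `‖G_n‖ → 0`. -/
def nullIdeal : Ideal seqAlg where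
  carrier := {G | Tendsto (fun n => ‖G.1 n‖) atTop (𝓝 0)}
  add_mem' := by
    intro A B hA hB
    have h : ∀ n, ‖(A + B).1 n‖ ≤ ‖A.1 n‖ + ‖B.1 n‖ := fun n => norm_add_le (A.1 n) (B.1 n)
    exact squeeze_zero (fun n => norm_nonneg _) h (by simpa using Tendsto.add hA hB)
  zero_mem' := by
    have h : ∀ n, ‖(0 : seqAlg).1 n‖ = 0 := fun n => norm_zero
    exact tendsto_const_nhds.congr fun n => (h n).symm
  smul_mem' := by
    intro C A hA
    have h : ∀ n, ‖(C * A).1 n‖ ≤ ‖C.1‖ * ‖A.1 n‖ := fun n =>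
      (norm_mul_le (C.1 n) (A.1 n)).trans (by gcongr; exact C.1.norm_apply_le n)
    exact squeeze_zero (fun n => norm_nonneg _) h (by simpa using Tendsto.const_mul ‖C.1‖ hA)

instance nullIdeal_isTwoSided : nullIdeal.IsTwoSided := ⟨by
  intro A C hA
  have h : ∀ n, ‖(A * C).1 n‖ ≤ ‖A.1 n‖ * ‖C.1‖ := fun n =>
    (norm_mul_le (A.1 n) (C.1 n)).trans (by gcongr; exact C.1.norm_apply_le n)
  exact squeeze_zero (fun n => norm_nonneg _) h (by simpa using Tendsto.mul_const ‖C.1‖ hA)⟩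

/-- The stability spectrum of `𝐀`: the spectrum of the coset `𝐀 + 𝓖` in `𝓕^𝒫 / 𝓖`. -/
def stabilitySpectrum (A : seqAlg) : Set ℂ :=
  spectrum ℂ (Ideal.Quotient.mk nullIdeal A)

/-- The strong limit `W(𝐀) = s-lim A_n P_n`. -/
def W (A : seqAlg) : L2N →L[ℂ] L2N := A.2.1.choose

theorem isStrongLimit_W (A : seqAlg) : IsStrongLimit A.1 (W A) := A.2.1.choose_spec

theorem W_eq {A : seqAlg} {T : L2N →L[ℂ] L2N} (h : IsStrongLimit A.1 T) : W A = T :=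
  ContinuousLinearMap.ext fun x => tendsto_nhds_unique (isStrongLimit_W A x) (h x)

/-- The absolute value `(𝐀^* 𝐀)^{1/2}` in the `C*`-algebra `𝓕^𝒫`. -/
def absSeq (A : seqAlg) : seqAlg := cfc Real.sqrt (star A * A)

/-- The finite section `P_n T P_n` as an operator on `im P_n`. -/
def finSection (n : ℕ) (T : L2N →L[ℂ] L2N) : ImP n →L[ℂ] ImP n :=
  firstEntries n ∘L T ∘L inclusion n

theorem norm_finSection_le (n : ℕ) (T : L2N →L[ℂ] L2N) : ‖finSection n T‖ ≤ ‖T‖ := by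
  refine (ContinuousLinearMap.opNorm_comp_le _ _).trans ?_
  have h3 : ‖T ∘L inclusion n‖ ≤ ‖T‖ := (ContinuousLinearMap.opNorm_comp_le T (inclusion n)).trans
    (mul_le_of_le_one_right (norm_nonneg _) (norm_inclusion_le n))
  exact (mul_le_of_le_one_left (norm_nonneg _) (norm_firstEntries_le n)).trans h3

theorem star_finSection (n : ℕ) (T : L2N →L[ℂ] L2N) :
    star (finSection n T) = finSection n (star T) := by
  simp only [ContinuousLinearMap.star_eq_adjoint, finSection, ContinuousLinearMap.adjoint_comp,
    inclusion, ContinuousLinearMap.adjoint_adjoint]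
  rfl

/-- The bounded sequence `(P_n T P_n)`. -/
def finSectionsBdd (T : L2N →L[ℂ] L2N) : BddSeq :=
  BddSeq.of (fun n => finSection (n + 1) T) ‖T‖ fun n => norm_finSection_le (n + 1) T

theorem isStrongLimit_finSections (T : L2N →L[ℂ] L2N) : IsStrongLimit (finSectionsBdd T) T := by
  intro x
  have h1 : ∀ n, extendOp (finSectionsBdd T n) x
      = inclusion (n + 1) (firstEntries (n + 1) (T x))
        + inclusion (n + 1) (firstEntries (n + 1)
          (T (inclusion (n + 1) (firstEntries (n + 1) x) - x))) := by
    intro n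
    rw [← map_add, ← map_add, ← map_add, add_sub_cancel]
    rfl
  simp only [h1]
  have h2 : Tendsto (fun n => inclusion (n + 1) (firstEntries (n + 1)
      (T (inclusion (n + 1) (firstEntries (n + 1) x) - x)))) atTop (𝓝 0) := by
    have h3 := (tendsto_iff_norm_sub_tendsto_zero.1 (tendsto_proj x)).const_mul ‖T‖
    rw [mul_zero] at h3
    refine squeeze_zero_norm (fun n => ?_) h3
    refine ((inclusion (n + 1)).le_of_opNorm_le (norm_inclusion_le _) _).trans ?_
    rw [one_mul]
    refine ((firstEntries (n + 1)).le_of_opNorm_le (norm_firstEntries_le _) _).trans ?_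
    rw [one_mul]
    exact T.le_opNorm _
  simpa using (tendsto_proj (T x)).add h2

/-- The finite sections sequence `(P_n T P_n)` as an element of `𝓕^𝒫`. -/
def finSections (T : L2N →L[ℂ] L2N) : seqAlg :=
  ⟨finSectionsBdd T, ⟨T, isStrongLimit_finSections T⟩, star T, by
    have h : star (finSectionsBdd T) = finSectionsBdd (star T) :=
      BddSeq.ext fun n => star_finSection (n + 1) T
    rw [h]
    exact isStrongLimit_finSections _⟩

theorem W_finSections (T : L2N →L[ℂ] L2N) : W (finSections T) = T :=
  W_eq (isStrongLimit_finSections T)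

/-- The algebra `𝒮_{L^∞(𝕋), AP(ℤ)}(ℤ⁺)`: the smallest closed `C*`-subalgebra of `𝓕^𝒫` which
contains all sequences `(P_n A P_n)` with `A ∈ 𝒜_{L^∞(𝕋), AP(ℤ)}(ℤ⁺)`. -/
def sectionsAlg : StarSubalgebra ℂ seqAlg :=
  (StarAlgebra.adjoin ℂ (finSections '' (opAlg : Set (L2N →L[ℂ] L2N)))).topologicalClosure

/-! ### Main diagonals, mean values and singular value averages -/

/-- The entries `a_{nn}` of the main diagonal `D(A)` of an operator `A` on `l²(ℤ⁺)`. -/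
def mainDiag (A : L2N →L[ℂ] L2N) (n : ℕ) : ℂ := A (lp.single 2 n (1 : ℂ)) n

/-- `f` is the almost periodic part of the main diagonal of `A`: `f ∈ AP(ℤ)` and
`D(A) - P f P ∈ c₀(ℤ⁺)`. -/
def IsDap (A : L2N →L[ℂ] L2N) (f : ℤ →ᵇ ℂ) : Prop :=
  IsAP f ∧ Tendsto (fun n : ℕ => mainDiag A n - f n) atTop (𝓝 0)

/-- Along a subsequence, the translates of an almost periodic function converge uniformly. -/
theorem IsAP.exists_subseq {a : ℤ →ᵇ ℂ} (ha : IsAP a) (k : ℕ → ℤ) :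
    ∃ φ : ℕ → ℕ, StrictMono φ ∧ CauchySeq fun i => translate (k (φ i)) a := by
  obtain ⟨b, -, φ, hφ, hb⟩ := ha.tendsto_subseq (x := fun i => translate (k i) a)
    fun i => subset_closure ⟨k i, rfl⟩
  exact ⟨φ, hφ, hb.cauchySeq⟩

/-- The almost periodic part of the main diagonal is unique. -/
theorem IsDap.unique {A : L2N →L[ℂ] L2N} {f₁ f₂ : ℤ →ᵇ ℂ} (h₁ : IsDap A f₁) (h₂ : IsDap A f₂) :
    f₁ = f₂ := by
  have hd : Tendsto (fun n : ℕ => f₁ n - f₂ n) atTop (𝓝 0) := by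
    simpa using h₂.2.sub h₁.2
  obtain ⟨φ, hφ, hc₁⟩ := h₁.1.exists_subseq fun i => (i : ℤ)
  obtain ⟨ψ, hψ, hc₂⟩ := h₂.1.exists_subseq fun i => (φ i : ℤ)
  have hc₁' : CauchySeq fun i => translate (φ (ψ i) : ℤ) f₁ :=
    hc₁.comp_tendsto hψ.tendsto_atTop
  ext n
  refine sub_eq_zero.1 (norm_le_zero_iff.1 (le_of_forall_pos_le_add fun ε hε => ?_))
  obtain ⟨N₁, hN₁⟩ := Metric.cauchySeq_iff.1 hc₁' (ε / 3) (by positivity)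
  obtain ⟨N₂, hN₂⟩ := Metric.cauchySeq_iff.1 hc₂ (ε / 3) (by positivity)
  obtain ⟨K, hK⟩ := Metric.tendsto_atTop.1 hd (ε / 3) (by positivity)
  set N := max N₁ N₂
  set p : ℕ := φ (ψ N)
  set j : ℕ := max N (K + p + n.natAbs)
  have hj : K + p + n.natAbs ≤ φ (ψ j) :=
    (le_max_right N _).trans ((hψ.id_le j).trans (hφ.id_le _))
  have e₁ := (BoundedContinuousFunction.dist_coe_le_dist (n - p)).trans_lt
    (hN₁ j ((le_max_left _ _).trans (le_max_left _ _)) N (le_max_left _ _))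
  have e₂ := (BoundedContinuousFunction.dist_coe_le_dist (n - p)).trans_lt
    (hN₂ j ((le_max_right _ _).trans (le_max_left _ _)) N (le_max_right _ _))
  have ht : ∀ (a : ℤ →ᵇ ℂ) (k m : ℤ), translate k a m = a (m + k) := fun _ _ _ => rfl
  obtain ⟨m, hm⟩ : ∃ m : ℕ, (m : ℤ) = n - p + φ (ψ j) :=
    ⟨(n - p + φ (ψ j)).toNat, Int.toNat_of_nonneg (by omega)⟩
  have e₃ := hK m (by omega)
  simp only [ht, dist_eq_norm] at e₁ e₂ e₃
  rw [← hm, show n - (p : ℤ) + (φ (ψ N) : ℤ) = n by simp [p]] at e₁ e₂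
  have e₄ : f₁ n - f₂ n = (f₁ m - f₂ m - 0) - (f₁ m - f₁ n) + (f₂ m - f₂ n) := by ring
  rw [e₄]
  have e₅ := norm_add_le ((f₁ m - f₂ m - 0) - (f₁ m - f₁ n)) (f₂ m - f₂ n)
  have e₆ := norm_sub_le (f₁ m - f₂ m - 0) (f₁ m - f₁ n)
  linarith

open Classical in
/-- The almost periodic part `D_ap(A)` of the main diagonal of `A` (with the value `0` if the main
diagonal of `A` is not the sum of an almost periodic function and a null sequence). -/
def Dap (A : L2N →L[ℂ] L2N) : ℤ →ᵇ ℂ := if h : ∃ f, IsDap A f then h.choose else 0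

theorem Dap_eq {A : L2N →L[ℂ] L2N} {f : ℤ →ᵇ ℂ} (h : IsDap A f) : Dap A = f := by
  have h' : ∃ f, IsDap A f := ⟨f, h⟩
  rw [Dap, dif_pos h']
  exact h'.choose_spec.unique h

/-- The arithmetic means `(a(0) + … + a(n - 1)) / n`. -/
def means (a : ℤ →ᵇ ℂ) (n : ℕ) : ℂ := (∑ r ∈ Finset.range n, a r) / n

/-- The mean value `M(a)` of an almost periodic function: the limit of the arithmetic means. -/
def meanValue (a : ℤ →ᵇ ℂ) : ℂ := limUnder atTop (means a)

/-- `(g(σ_1(T)) + … + g(σ_n(T))) / n`, where `σ_1(T), …, σ_n(T)` are the singular values of the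
operator `T` on the `n`-dimensional space `im P_n`, counted with multiplicity. -/
def singularAverage (g : ℝ → ℂ) {n : ℕ} (T : ImP n →L[ℂ] ImP n) : ℂ :=
  (∑ i ∈ Finset.range n, g ((T : ImP n →ₗ[ℂ] ImP n).singularValues i)) / n

/-- The value `g(T)` of the continuous functional calculus at a self-adjoint operator `T`, for a
complex-valued function `g` of a real variable which is continuous on the spectrum of `T`. -/
def applyFun (g : ℝ → ℂ) (T : L2N →L[ℂ] L2N) : L2N →L[ℂ] L2N := cfc (fun z : ℂ => g z.re) T

end SzegoAP

end

open SzegoAP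

/-!
The sequences in `sectionsAlg` are compared with the finite sections of their strong limit in the
normalised Hilbert-Schmidt norm, and the diagonal of an operator in `opAlg` is controlled through
its matrix entries.

* Operators. Call a sequence on `ℤ⁺` asymptotically almost periodic if it is the sum of (the
  restriction of) an almost periodic function and a null sequence. The operators all of whose
  diagonals are asymptotically almost periodic and whose columns and rows are, in the `l²`-norm,
  uniformly concentrated near the main diagonal form a closed `C*`-algebra `aapAlg`: an entry of a
  product is `∑ l, a_{j+k,j+l} b_{j+l,j}`, and the concentration of the columns makes this series
  converge uniformly in `j`. The columns of a Toeplitz operator are cut-offs of shifts of a single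
  `l²`-sequence, so `aapAlg` contains the generators of `opAlg`, and therefore `opAlg`. This gives
  the existence of `D_ap` (`exists_isDap`); its mean value exists because sums of an almost periodic
  function over intervals of equal length almost agree (`IsAP.exists_tendsto_means`).

* Sequences. If the columns of `B` are uniformly concentrated near the diagonal, then only few
  columns of `(I - P_n) B P_n` are not small, so `P_n A P_n B P_n - P_n A B P_n` has Hilbert-Schmidt
  norm `o(√n)` (`isHSNull_finSections_mul_sub`). Bounded sequences with this property form a closed
  ideal, so the sequences `𝐀` with `W(𝐀)` in `opAlg` and `A_n - P_n W(𝐀) P_n` in this ideal form a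
  closed `C*`-algebra (`averageAlg`), which contains `sectionsAlg`. In particular
  `tr A_n / n - tr (P_n W(𝐀) P_n) / n → 0`.

* Spectra. A point outside the stability spectrum has a neighbourhood free of eigenvalues of `B_n`
  for all large `n`. By compactness the singular values of `A_n`, which are the eigenvalues of
  `B_n`, lie in a fixed compact subset of `U` for large `n` (`exists_isCompact_eigenvalues`). There
  and on the spectrum of `W(𝐁)` the function `g` coincides with a continuous function `f` on `ℝ`.
  The theorem is the statement about traces applied to the sequence `f(𝐁)`, whose strong limit is
  `f(W(𝐁)) = g(W(𝐁))` and whose entries have trace `∑ f(σ_i(A_n))`.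
-/

namespace SzegoAP

/-! ### Almost periodic functions -/

theorem translate_apply (k : ℤ) (a : ℤ →ᵇ ℂ) (n : ℤ) : translate k a n = a (n + k) := rfl

theorem dist_translate_le (k : ℤ) (a b : ℤ →ᵇ ℂ) :
    dist (translate k a) (translate k b) ≤ dist a b :=
  (BoundedContinuousFunction.dist_le dist_nonneg).2 fun n =>
    BoundedContinuousFunction.dist_coe_le_dist (n + k)

theorem IsAP.of_forall_mem {a : ℤ →ᵇ ℂ} {K : Set (ℤ →ᵇ ℂ)} (hK : IsCompact K)
    (h : ∀ k, translate k a ∈ K) : IsAP a :=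
  hK.closure_of_subset (Set.range_subset_iff.2 h)

theorem isAP_const (c : ℂ) : IsAP (BoundedContinuousFunction.const ℤ c) :=
  .of_forall_mem (isCompact_singleton (x := BoundedContinuousFunction.const ℤ c)) fun _ => rfl

theorem IsAP.add {a b : ℤ →ᵇ ℂ} (ha : IsAP a) (hb : IsAP b) : IsAP (a + b) :=
  .of_forall_mem ((ha.prod hb).image continuous_add) fun k =>
    ⟨(translate k a, translate k b), ⟨subset_closure ⟨k, rfl⟩, subset_closure ⟨k, rfl⟩⟩, rfl⟩

theorem IsAP.mul {a b : ℤ →ᵇ ℂ} (ha : IsAP a) (hb : IsAP b) : IsAP (a * b) :=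
  .of_forall_mem ((ha.prod hb).image continuous_mul) fun k =>
    ⟨(translate k a, translate k b), ⟨subset_closure ⟨k, rfl⟩, subset_closure ⟨k, rfl⟩⟩, rfl⟩

theorem IsAP.star {a : ℤ →ᵇ ℂ} (ha : IsAP a) : IsAP (star a) :=
  .of_forall_mem (ha.image continuous_star) fun k =>
    ⟨translate k a, subset_closure ⟨k, rfl⟩, rfl⟩

theorem IsAP.translate {a : ℤ →ᵇ ℂ} (ha : IsAP a) (k : ℤ) : IsAP (translate k a) :=
  .of_forall_mem ha fun l => subset_closure ⟨k + l, by
    ext n; simp only [translate_apply]; congr 1; ring⟩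

/-- Almost periodicity is preserved under uniform limits. -/
theorem IsAP.of_forall_dist_le {a : ℤ →ᵇ ℂ}
    (h : ∀ ε > 0, ∃ b, IsAP b ∧ dist a b ≤ ε) : IsAP a := by
  refine TotallyBounded.isCompact_of_isClosed (TotallyBounded.closure ?_) isClosed_closure
  refine Metric.totallyBounded_iff.2 fun ε hε => ?_
  obtain ⟨b, hb, hab⟩ := h (ε / 3) (by positivity)
  obtain ⟨t, ht, hbt⟩ := Metric.totallyBounded_iff.1 hb.totallyBounded (ε / 3) (by positivity)
  refine ⟨t, ht, ?_⟩
  rintro _ ⟨k, rfl⟩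
  obtain ⟨y, hy, hk⟩ := Set.mem_iUnion₂.1 (hbt (subset_closure ⟨k, rfl⟩))
  refine Set.mem_iUnion₂.2 ⟨y, hy, ?_⟩
  rw [Metric.mem_ball] at hk ⊢
  have h1 := dist_triangle (SzegoAP.translate k a) (SzegoAP.translate k b) y
  have h2 := dist_translate_le k a b
  linarith

/-- An almost periodic function has arbitrarily large `ε`-almost periods. -/
theorem IsAP.exists_almostPeriod {a : ℤ →ᵇ ℂ} (ha : IsAP a) {ε : ℝ} (hε : 0 < ε) (N : ℕ) :
    ∃ p : ℕ, N ≤ p ∧ ∀ n : ℤ, dist (a (n + p)) (a n) ≤ ε := by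
  obtain ⟨φ, hφ, hc⟩ := ha.exists_subseq fun i => (i : ℤ)
  obtain ⟨M, hM⟩ := Metric.cauchySeq_iff.1 hc ε hε
  have hle : φ M + N ≤ φ (M + (φ M + N)) := (Nat.le_add_left _ _).trans (hφ.id_le _)
  refine ⟨φ (M + (φ M + N)) - φ M, by omega, fun n => ?_⟩
  have h := (BoundedContinuousFunction.dist_coe_le_dist (n - φ M)).trans_lt
    (hM (M + (φ M + N)) (Nat.le_add_right _ _) M le_rfl)
  rw [translate_apply, translate_apply] at h
  rw [sub_add_cancel] at h
  rw [Nat.cast_sub (by omega), ← add_sub_assoc, add_sub_right_comm]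
  exact h.le

/-- The supremum norm distance of almost periodic functions is determined near `+∞`. -/
theorem IsAP.dist_le {a b : ℤ →ᵇ ℂ} (ha : IsAP a) (hb : IsAP b) {c : ℝ} (hc : 0 ≤ c)
    (h : ∀ᶠ n : ℕ in atTop, dist (a n) (b n) ≤ c) : dist a b ≤ c := by
  -- an almost period of `a - b` carries any `n` to an integer near `+∞`
  have hd : IsAP (a + BoundedContinuousFunction.const ℤ (-1) * b) := ha.add ((isAP_const _).mul hb)
  refine (BoundedContinuousFunction.dist_le hc).2 fun n => le_of_forall_pos_le_add fun ε hε => ?_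
  obtain ⟨N, hN⟩ := eventually_atTop.1 h
  obtain ⟨p, hp, hd⟩ := hd.exists_almostPeriod hε (N + n.natAbs)
  obtain ⟨m, hm⟩ : ∃ m : ℕ, (m : ℤ) = n + p := ⟨(n + p).toNat, Int.toNat_of_nonneg (by omega)⟩
  have h1 := hd n
  have h2 := hN m (by omega)
  rw [← hm] at h1
  simp only [BoundedContinuousFunction.coe_add, BoundedContinuousFunction.coe_mul, Pi.add_apply,
    Pi.mul_apply, BoundedContinuousFunction.const_apply, dist_eq_norm] at h1 h2 ⊢
  have h3 : a n - b n = (a m - b m) - (a m + -1 * b m - (a n + -1 * b n)) := by ring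
  rw [h3]
  exact (norm_sub_le _ _).trans (add_le_add h2 h1)

/-- Sums of an almost periodic function over intervals of the same length are almost independent of
the position of the interval. -/
theorem IsAP.exists_norm_sum_sub_sum_le {f : ℤ →ᵇ ℂ} (hf : IsAP f) {ε : ℝ} (hε : 0 < ε) :
    ∃ C : ℝ, ∀ (n : ℕ) (x : ℤ),
      ‖∑ r ∈ Finset.range n, f (r + x) - ∑ r ∈ Finset.range n, f r‖ ≤ n * ε + C := by
  have hshift : ∀ k : ℤ, ∃ C : ℝ, ∀ n : ℕ,
      ‖∑ r ∈ Finset.range n, f (r + k) - ∑ r ∈ Finset.range n, f r‖ ≤ C := by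
    have hstep : ∀ (n : ℕ) (k : ℤ), ‖∑ r ∈ Finset.range n, f (r + (k + 1))
        - ∑ r ∈ Finset.range n, f (r + k)‖ ≤ ‖f‖ + ‖f‖ := by
      intro n k
      have h := Finset.sum_range_sub (fun r : ℕ => f (r + k)) n
      rw [← Finset.sum_sub_distrib]
      have h' : ∀ r : ℕ, f (r + (k + 1)) - f (r + k) = f ((r + 1 : ℕ) + k) - f (r + k) := by
        intro r
        congr 2
        push_cast
        ring
      rw [Finset.sum_congr rfl fun r _ => h' r, h]
      exact (norm_sub_le _ _).trans (add_le_add (f.norm_coe_le_norm _) (f.norm_coe_le_norm _))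
    intro k
    induction k using Int.induction_on with
    | zero => exact ⟨0, fun n => by simp⟩
    | succ k ih =>
      obtain ⟨C, hC⟩ := ih
      exact ⟨‖f‖ + ‖f‖ + C, fun n => (norm_sub_le_norm_sub_add_norm_sub _ _ _).trans
        (add_le_add (hstep n k) (hC n))⟩
    | pred k ih =>
      obtain ⟨C, hC⟩ := ih
      refine ⟨‖f‖ + ‖f‖ + C, fun n => (norm_sub_le_norm_sub_add_norm_sub _ _ _).trans
        (add_le_add ?_ (hC n))⟩
      have := hstep n (-k - 1)
      rwa [sub_add_cancel, norm_sub_rev] at this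
  choose C hC using hshift
  obtain ⟨t, ht, htf, hft⟩ := Metric.finite_approx_of_totallyBounded
    (hf.totallyBounded.subset subset_closure) ε hε
  -- every translate of `f` is `ε`-close to one of finitely many translates, and for each of these
  -- the sums differ from those of `f` by boundedly many terms
  choose! κ hκ using fun y (hy : y ∈ t) => ht hy
  obtain ⟨B, hB⟩ := (htf.image fun y => C (κ y)).bddAbove
  refine ⟨B, fun n x => ?_⟩
  obtain ⟨y, hy, hxy⟩ := Set.mem_iUnion₂.1 (hft ⟨x, rfl⟩)
  refine (norm_sub_le_norm_sub_add_norm_sub _ (∑ r ∈ Finset.range n, f (r + κ y)) _).trans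
    (add_le_add ?_ ((hC (κ y) n).trans (hB ⟨y, hy, rfl⟩)))
  rw [← Finset.sum_sub_distrib]
  refine (norm_sum_le_of_le _ fun r _ => ?_).trans_eq (?_ : ∑ r ∈ Finset.range n, ε = n * ε)
  · rw [← dist_eq_norm, ← translate_apply, ← translate_apply,
      show SzegoAP.translate (κ y) f = y from hκ y hy]
    exact (BoundedContinuousFunction.dist_coe_le_dist _).trans (Metric.mem_ball.1 hxy).le
  · simp

/-- The arithmetic means of an almost periodic function converge. -/
theorem IsAP.exists_tendsto_means {f : ℤ →ᵇ ℂ} (hf : IsAP f) :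
    ∃ c, Tendsto (means f) atTop (𝓝 c) := by
  have hblock : ∀ ε > 0, ∃ C : ℝ, ∀ n m : ℕ, ‖∑ r ∈ Finset.range (n * m), f r
      - m * ∑ r ∈ Finset.range n, f r‖ ≤ m * (n * ε + C) := by
    intro ε hε
    obtain ⟨C, hC⟩ := hf.exists_norm_sum_sub_sum_le hε
    -- the interval of length `n * m` is split into `m` blocks of length `n`
    refine ⟨C, fun n m => ?_⟩
    induction m with
    | zero => simp
    | succ m ih =>
      rw [mul_add_one, Finset.sum_range_add]
      have h1 := hC n (n * m : ℕ)
      have h2 : ∑ r ∈ Finset.range (n * m), f r + ∑ r ∈ Finset.range n, f ((n * m + r : ℕ) : ℤ)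
          - ((m + 1 : ℕ) : ℂ) * ∑ r ∈ Finset.range n, f r
          = (∑ r ∈ Finset.range (n * m), f r - m * ∑ r ∈ Finset.range n, f r)
            + (∑ r ∈ Finset.range n, f (r + (n * m : ℕ)) - ∑ r ∈ Finset.range n, f r) := by
        have h3 : ∀ r : ℕ, ((n * m + r : ℕ) : ℤ) = r + (n * m : ℕ) := fun r => by
          push_cast; ring
        simp only [h3]
        push_cast
        ring
      rw [h2]
      refine (norm_add_le _ _).trans ((add_le_add ih h1).trans_eq ?_)
      push_cast
      ring
  refine cauchySeq_tendsto_of_complete (Metric.cauchySeq_iff.2 fun ε hε => ?_)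
  obtain ⟨C, hC⟩ := hblock (ε / 4) (by positivity)
  have hC0 : 0 ≤ C := by simpa using hC 0 1
  have hclose : ∀ n m : ℕ, 0 < n → 0 < m → ‖means f (n * m) - means f n‖ ≤ ε / 4 + C / n := by
    intro n m hn hm
    have hn' : (n : ℂ) ≠ 0 := by exact_mod_cast hn.ne'
    have hm' : (m : ℂ) ≠ 0 := by exact_mod_cast hm.ne'
    have hnR : (0 : ℝ) < n := by exact_mod_cast hn
    have hmR : (0 : ℝ) < m := by exact_mod_cast hm
    have h1 : means f (n * m) - means f n = (∑ r ∈ Finset.range (n * m), f r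
        - m * ∑ r ∈ Finset.range n, f r) / (n * m) := by
      rw [means, means, Nat.cast_mul]
      field_simp
    rw [h1, norm_div, norm_mul, Complex.norm_natCast, Complex.norm_natCast,
      div_le_iff₀ (by positivity)]
    refine (hC n m).trans_eq ?_
    field_simp
  obtain ⟨N, hN⟩ := exists_nat_gt (4 * C / ε)
  have hsmall : ∀ n : ℕ, N + 1 ≤ n → C / n < ε / 4 := by
    intro n hn
    have hn' : ((N : ℝ) + 1) ≤ n := by exact_mod_cast hn
    have hN0 : (0 : ℝ) ≤ N := N.cast_nonneg
    rw [div_lt_iff₀ (by linarith)]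
    rw [div_lt_iff₀ hε] at hN
    nlinarith
  refine ⟨N + 1, fun n hn m hm => ?_⟩
  have h1 := hclose n m (by omega) (by omega)
  have h2 := hclose m n (by omega) (by omega)
  rw [mul_comm m n] at h2
  rw [← dist_eq_norm] at h1 h2
  linarith [dist_triangle_left (means f n) (means f m) (means f (n * m)), hsmall n hn, hsmall m hm]

theorem IsAP.tendsto_means {f : ℤ →ᵇ ℂ} (hf : IsAP f) :
    Tendsto (means f) atTop (𝓝 (meanValue f)) :=
  tendsto_nhds_limUnder hf.exists_tendsto_means

/-! ### Asymptotically almost periodic sequences -/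

/-- The sequence `d` on `ℤ⁺` is the sum of the restriction of an almost periodic function and a
null sequence. -/
def IsAAP (d : ℕ → ℂ) : Prop :=
  ∃ f : ℤ →ᵇ ℂ, IsAP f ∧ Tendsto (fun n : ℕ => d n - f n) atTop (𝓝 0)

theorem IsAAP.congr' {d e : ℕ → ℂ} (hd : IsAAP d) (h : d =ᶠ[atTop] e) : IsAAP e := by
  obtain ⟨f, hf, hdf⟩ := hd
  refine ⟨f, hf, hdf.congr' ?_⟩
  filter_upwards [h] with n hn
  rw [hn]

theorem isAAP_const (c : ℂ) : IsAAP fun _ => c :=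
  ⟨_, isAP_const c, by simp⟩

theorem IsAAP.add {d e : ℕ → ℂ} (hd : IsAAP d) (he : IsAAP e) : IsAAP fun n => d n + e n := by
  obtain ⟨f, hf, hdf⟩ := hd
  obtain ⟨g, hg, heg⟩ := he
  refine ⟨f + g, hf.add hg, ?_⟩
  simpa [add_sub_add_comm] using hdf.add heg

theorem IsAAP.sum {ι : Type*} (s : Finset ι) {d : ι → ℕ → ℂ} (hd : ∀ i ∈ s, IsAAP (d i)) :
    IsAAP fun n => ∑ i ∈ s, d i n := by
  classical
  induction s using Finset.induction_on with
  | empty => simpa using isAAP_const 0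
  | insert i s hi ih =>
    simp only [Finset.sum_insert hi]
    exact (hd i (by simp)).add (ih fun j hj => hd j (by simp [hj]))

theorem IsAAP.mul {d e : ℕ → ℂ} (hd : IsAAP d) (he : IsAAP e) : IsAAP fun n => d n * e n := by
  obtain ⟨f, hf, hdf⟩ := hd
  obtain ⟨g, hg, heg⟩ := he
  refine ⟨f * g, hf.mul hg, ?_⟩
  have hfb : IsBoundedUnder (· ≤ ·) atTop (norm ∘ fun n : ℕ => f n) :=
    isBoundedUnder_of ⟨‖f‖, fun n => f.norm_coe_le_norm _⟩
  have hgb : IsBoundedUnder (· ≤ ·) atTop (norm ∘ fun n : ℕ => g n) :=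
    isBoundedUnder_of ⟨‖g‖, fun n => g.norm_coe_le_norm _⟩
  have h := ((hdf.mul heg).add (hdf.zero_mul_isBoundedUnder_le hgb)).add
    (heg.zero_mul_isBoundedUnder_le hfb)
  simp only [mul_zero, add_zero] at h
  refine h.congr fun n => ?_
  simp only [BoundedContinuousFunction.coe_mul, Pi.mul_apply]
  ring

theorem IsAAP.star {d : ℕ → ℂ} (hd : IsAAP d) : IsAAP fun n => star (d n) := by
  obtain ⟨f, hf, hdf⟩ := hd
  exact ⟨Star.star f, hf.star, by simpa using hdf.star⟩

theorem IsAAP.shift {d : ℕ → ℂ} (hd : IsAAP d) (k : ℤ) : IsAAP fun n => d (n + k).toNat := by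
  obtain ⟨f, hf, hdf⟩ := hd
  refine ⟨translate k f, hf.translate k, ?_⟩
  have ht : Tendsto (fun n : ℕ => (n + k).toNat) atTop atTop :=
    tendsto_atTop.2 fun b => eventually_atTop.2 ⟨b + k.natAbs, fun n hn => by omega⟩
  refine (hdf.comp ht).congr' (eventually_atTop.2 ⟨k.natAbs, fun n hn => ?_⟩)
  show d (n + k).toNat - f ((n + k).toNat : ℤ) = d (n + k).toNat - f (n + k)
  rw [Int.toNat_of_nonneg (by omega)]

/-- Asymptotic almost periodicity is preserved under uniform limits. -/
theorem IsAAP.of_forall_dist_le {d : ℕ → ℂ}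
    (h : ∀ ε > 0, ∃ e, IsAAP e ∧ ∀ᶠ n in atTop, dist (d n) (e n) ≤ ε) : IsAAP d := by
  have h' : ∀ ε > 0, ∃ f : ℤ →ᵇ ℂ, IsAP f ∧ ∀ᶠ n : ℕ in atTop, dist (d n) (f n) ≤ ε := by
    intro ε hε
    obtain ⟨e, ⟨f, hf, hef⟩, hde⟩ := h (ε / 2) (by positivity)
    refine ⟨f, hf, ?_⟩
    filter_upwards [hde, Metric.tendsto_nhds.1 hef (ε / 2) (by positivity)] with n h1 h2
    rw [dist_zero_right, ← dist_eq_norm] at h2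
    linarith [dist_triangle (d n) (e n) (f n)]
  obtain ⟨u, -, hu, hu0⟩ := exists_seq_strictAnti_tendsto (0 : ℝ)
  choose f hf hdf using fun k => h' (u k) (hu k)
  have hfd : ∀ k l, dist (f k) (f l) ≤ u k + u l := fun k l =>
    (hf k).dist_le (hf l) (add_pos (hu k) (hu l)).le (by
      filter_upwards [hdf k, hdf l] with n h1 h2
      exact (dist_triangle_left _ _ _).trans (add_le_add h1 h2))
  have hc : CauchySeq f := by
    refine Metric.cauchySeq_iff.2 fun ε hε => ?_
    obtain ⟨N, hN⟩ := eventually_atTop.1 (hu0.eventually (gt_mem_nhds (half_pos hε)))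
    exact ⟨N, fun k hk l hl => (hfd k l).trans_lt (by linarith [hN k hk, hN l hl])⟩
  obtain ⟨g, hg⟩ := cauchySeq_tendsto_of_complete hc
  refine ⟨g, .of_forall_dist_le fun ε hε => ?_, Metric.tendsto_nhds.2 fun ε hε => ?_⟩
  · obtain ⟨k, hk⟩ := (Metric.tendsto_nhds.1 hg ε hε).exists
    exact ⟨f k, hf k, by rw [dist_comm]; exact hk.le⟩
  · obtain ⟨k, hk, hk'⟩ := ((Metric.tendsto_nhds.1 hg (ε / 2) (by positivity)).and
      (hu0.eventually (gt_mem_nhds (half_pos hε)))).exists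
    filter_upwards [hdf k] with n hn
    have h1 := (BoundedContinuousFunction.dist_coe_le_dist (f := f k) (g := g) (n : ℤ))
    rw [dist_zero_right, ← dist_eq_norm]
    linarith [dist_triangle (d n) (f k n) (g n)]


/-! ### Truncated columns -/

/-- The `j`th standard basis vector of `l²(ℤ⁺)`. -/
noncomputable def basisVec (j : ℕ) : L2N := lp.single 2 j (1 : ℂ)

theorem norm_basisVec (j : ℕ) : ‖basisVec j‖ = 1 := by
  rw [basisVec, lp.norm_single (by norm_num), norm_one]

theorem inner_basisVec (j : ℕ) (x : L2N) : inner ℂ (basisVec j) x = x j := by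
  rw [basisVec, lp.inner_single_left]; simp

theorem norm_coord_le (x : L2N) (j : ℕ) : ‖x j‖ ≤ ‖x‖ :=
  lp.norm_apply_le_norm (by norm_num) x j

theorem norm_apply_basisVec_le (A : L2N →L[ℂ] L2N) (j : ℕ) : ‖A (basisVec j)‖ ≤ ‖A‖ := by
  simpa [norm_basisVec] using A.le_opNorm (basisVec j)

theorem star_apply_basisVec (A : L2N →L[ℂ] L2N) (i j : ℕ) :
    (star A) (basisVec j) i = star (A (basisVec i) j) := by
  rw [← inner_basisVec, ContinuousLinearMap.star_eq_adjoint,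
    ContinuousLinearMap.adjoint_inner_right, ← inner_conj_symm, inner_basisVec]
  rfl

/-- The vector which agrees with `x` on the finite set `s` and vanishes elsewhere. -/
noncomputable def trunc (s : Finset ℕ) (x : L2N) : L2N := ∑ i ∈ s, x i • basisVec i

theorem trunc_apply (s : Finset ℕ) (x : L2N) (k : ℕ) :
    trunc s x k = if k ∈ s then x k else 0 := by
  simp only [trunc, lp.coeFn_sum, Finset.sum_apply, lp.coeFn_smul, Pi.smul_apply, basisVec,
    lp.single_apply]
  simp [Pi.single_apply]

/-- `trunc s x` is the best approximation to `x` among the vectors supported in `s`. -/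
theorem norm_sub_trunc_le {s : Finset ℕ} (x : L2N) {y : L2N} (hy : ∀ i ∉ s, y i = 0) :
    ‖x - trunc s x‖ ≤ ‖x - y‖ := by
  refine lp.norm_le_of_tsum_le (by norm_num) (norm_nonneg _) ?_
  rw [lp.norm_rpow_eq_tsum (by norm_num) (x - y)]
  have h := (lp.memℓp (x - y)).summable (by norm_num)
  have hle : ∀ i, ‖(x - trunc s x) i‖ ^ (2 : ℝ≥0∞).toReal ≤ ‖(x - y) i‖ ^ (2 : ℝ≥0∞).toReal := by
    intro i
    refine Real.rpow_le_rpow (norm_nonneg _) ?_ (by norm_num)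
    rw [lp.coeFn_sub, lp.coeFn_sub, Pi.sub_apply, Pi.sub_apply, trunc_apply]
    split_ifs with hi
    · simp
    · rw [hy i hi]
  exact Summable.tsum_le_tsum hle (h.of_nonneg_of_le (fun _ => by positivity) hle) h

theorem norm_sub_trunc_le_norm (s : Finset ℕ) (x : L2N) : ‖x - trunc s x‖ ≤ ‖x‖ := by
  simpa using norm_sub_trunc_le (s := s) x (y := 0) (fun _ _ => rfl)

/-- The indices at distance at most `m` from `j`. -/
def window (m j : ℕ) : Finset ℕ := Finset.Icc (j - m) (j + m)

theorem mem_window {m j i : ℕ} : i ∈ window m j ↔ i ≤ j + m ∧ j ≤ i + m := by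
  rw [window, Finset.mem_Icc]; omega

theorem card_window_le (m j : ℕ) : (window m j).card ≤ 2 * m + 1 := by
  rw [window, Nat.card_Icc]; omega

/-- The columns of the matrix of `A` are concentrated, uniformly in the `l²`-norm, near the main
diagonal. -/
def HasUniformColumns (A : L2N →L[ℂ] L2N) : Prop :=
  ∀ ε > 0, ∃ m : ℕ, ∀ j, ∃ y : L2N, (∀ i ∉ window m j, y i = 0) ∧ ‖A (basisVec j) - y‖ ≤ ε

theorem HasUniformColumns.exists_trunc {A : L2N →L[ℂ] L2N} (hA : HasUniformColumns A) {ε : ℝ}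
    (hε : 0 < ε) :
    ∃ m : ℕ, ∀ j, ‖A (basisVec j) - trunc (window m j) (A (basisVec j))‖ ≤ ε := by
  obtain ⟨m, hm⟩ := hA ε hε
  refine ⟨m, fun j => ?_⟩
  obtain ⟨y, hy, h⟩ := hm j
  exact (norm_sub_trunc_le _ hy).trans h

theorem hasUniformColumns_algebraMap (c : ℂ) :
    HasUniformColumns (algebraMap ℂ (L2N →L[ℂ] L2N) c) := by
  intro ε hε
  refine ⟨0, fun j => ⟨c • basisVec j, fun i hi => ?_, ?_⟩⟩
  · have : i ≠ j := fun h => hi (mem_window.2 (by omega))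
    simp [basisVec, this]
  · simp [Algebra.algebraMap_eq_smul_one, hε.le]

theorem HasUniformColumns.add {A B : L2N →L[ℂ] L2N} (hA : HasUniformColumns A)
    (hB : HasUniformColumns B) : HasUniformColumns (A + B) := by
  intro ε hε
  obtain ⟨m, hm⟩ := hA (ε / 2) (by positivity)
  obtain ⟨l, hl⟩ := hB (ε / 2) (by positivity)
  refine ⟨m + l, fun j => ?_⟩
  obtain ⟨y, hy, hAy⟩ := hm j
  obtain ⟨z, hz, hBz⟩ := hl j
  refine ⟨y + z, fun i hi => ?_, ?_⟩
  · rw [mem_window] at hi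
    rw [lp.coeFn_add, Pi.add_apply, hy i (by rw [mem_window]; omega),
      hz i (by rw [mem_window]; omega), add_zero]
  · rw [_root_.add_apply, add_sub_add_comm]
    exact (norm_add_le _ _).trans (by linarith)

/-- Expand the truncated `j`th column of `B` in basis vectors and truncate the corresponding columns
of `A`; the number of columns of `A` which are involved does not depend on `j`. -/
theorem HasUniformColumns.mul {A B : L2N →L[ℂ] L2N} (hA : HasUniformColumns A)
    (hB : HasUniformColumns B) : HasUniformColumns (A * B) := by
  intro ε hε
  obtain ⟨m, hm⟩ := hB.exists_trunc (ε := ε / (2 * (‖A‖ + 1))) (by positivity)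
  obtain ⟨l, hl⟩ := hA (ε / (2 * ((2 * m + 1) * (‖B‖ + 1)))) (by positivity)
  choose y hy hAy using hl
  refine ⟨m + l, fun j => ⟨∑ i ∈ window m j, B (basisVec j) i • y i, fun k hk => ?_, ?_⟩⟩
  · rw [lp.coeFn_sum, Finset.sum_apply]
    refine Finset.sum_eq_zero fun i hi => ?_
    rw [mem_window] at hi hk
    rw [lp.coeFn_smul, Pi.smul_apply, hy i k (by rw [mem_window]; omega), smul_zero]
  · have h1 : ‖A (B (basisVec j)) - A (trunc (window m j) (B (basisVec j)))‖ ≤ ε / 2 := by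
      rw [← map_sub]
      refine (A.le_opNorm _).trans ((mul_le_mul_of_nonneg_left (hm j) (norm_nonneg _)).trans ?_)
      rw [mul_div_assoc', div_le_div_iff₀ (by positivity) (by positivity)]
      nlinarith [norm_nonneg A]
    have h2 : ‖A (trunc (window m j) (B (basisVec j)))
        - ∑ i ∈ window m j, B (basisVec j) i • y i‖ ≤ ε / 2 := by
      rw [trunc, map_sum, ← Finset.sum_sub_distrib]
      refine (norm_sum_le_of_le (f := fun i => A (B (basisVec j) i • basisVec i)
        - B (basisVec j) i • y i) (n := fun _ => (‖B‖ + 1) *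
          (ε / (2 * ((2 * m + 1) * (‖B‖ + 1))))) _ fun i _ => ?_).trans ?_
      · rw [map_smul, ← smul_sub, norm_smul]
        have h3 : ‖B (basisVec j) i‖ ≤ ‖B‖ + 1 :=
          (norm_coord_le _ _).trans ((norm_apply_basisVec_le B j).trans (by linarith))
        exact mul_le_mul h3 (hAy i) (norm_nonneg _) (by positivity)
      · rw [Finset.sum_const, nsmul_eq_mul]
        have h4 : ((window m j).card : ℝ) ≤ 2 * m + 1 := by exact_mod_cast card_window_le m j
        refine (mul_le_mul_of_nonneg_right h4 (by positivity)).trans_eq ?_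
        field_simp
    exact (norm_sub_le_norm_sub_add_norm_sub _ _ _).trans ((add_le_add h1 h2).trans_eq (by ring))

theorem HasUniformColumns.of_closure {S : Set (L2N →L[ℂ] L2N)}
    (hS : ∀ B ∈ S, HasUniformColumns B) {A : L2N →L[ℂ] L2N} (hA : A ∈ closure S) :
    HasUniformColumns A := by
  intro ε hε
  obtain ⟨B, hB, hAB⟩ := Metric.mem_closure_iff.1 hA (ε / 2) (by positivity)
  obtain ⟨m, hm⟩ := hS B hB (ε / 2) (by positivity)
  refine ⟨m, fun j => ?_⟩
  obtain ⟨y, hy, hBy⟩ := hm j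
  refine ⟨y, hy, (norm_sub_le_norm_sub_add_norm_sub _ (B (basisVec j)) _).trans ?_⟩
  have h := norm_apply_basisVec_le (A - B) j
  rw [_root_.sub_apply] at h
  rw [dist_eq_norm] at hAB
  linarith

/-! ### Diagonals -/

/-- The entries `a_{j+k,j}`, `j ≥ 0`, of the `k`th diagonal of `A`.  The finitely many `j` with
`j + k < 0` carry the irrelevant value `a_{0,j}`. -/
noncomputable def diag (A : L2N →L[ℂ] L2N) (k : ℤ) (j : ℕ) : ℂ := A (basisVec j) (j + k).toNat

/-- All diagonals of `A` are asymptotically almost periodic. -/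
def HasAAPDiags (A : L2N →L[ℂ] L2N) : Prop := ∀ k, IsAAP (diag A k)

theorem hasAAPDiags_algebraMap (c : ℂ) : HasAAPDiags (algebraMap ℂ (L2N →L[ℂ] L2N) c) := by
  intro k
  refine (isAAP_const (if k = 0 then c else 0)).congr'
    (eventually_atTop.2 ⟨k.natAbs, fun n hn => ?_⟩)
  have h : (n + k).toNat = n ↔ k = 0 := by omega
  simp [diag, Algebra.algebraMap_eq_smul_one, basisVec, Pi.single_apply, h]

theorem HasAAPDiags.add {A B : L2N →L[ℂ] L2N} (hA : HasAAPDiags A) (hB : HasAAPDiags B) :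
    HasAAPDiags (A + B) := fun k => (hA k).add (hB k)

theorem HasAAPDiags.star {A : L2N →L[ℂ] L2N} (hA : HasAAPDiags A) : HasAAPDiags (star A) := by
  intro k
  refine ((hA (-k)).star.shift k).congr' (eventually_atTop.2 ⟨k.natAbs, fun n hn => ?_⟩)
  have h : (((n + k).toNat : ℤ) + -k).toNat = n := by omega
  simp only [diag]
  rw [star_apply_basisVec, h]

/-- The concentration of the columns of `B` allows the series for the entries of `A * B` to be
replaced by finite sums, uniformly along each diagonal. -/
theorem HasAAPDiags.mul {A B : L2N →L[ℂ] L2N} (hA : HasAAPDiags A) (hB : HasAAPDiags B)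
    (hB' : HasUniformColumns B) : HasAAPDiags (A * B) := by
  refine fun k => .of_forall_dist_le fun ε hε => ?_
  obtain ⟨m, hm⟩ := hB'.exists_trunc (ε := ε / (‖A‖ + 1)) (by positivity)
  refine ⟨fun j => ∑ l ∈ Finset.Icc (-m : ℤ) m, diag A (k - l) (j + l).toNat * diag B l j,
    .sum _ fun l _ => ((hA (k - l)).shift l).mul (hB l),
    eventually_atTop.2 ⟨m + k.natAbs, fun j hj => ?_⟩⟩
  have h1 : ∑ l ∈ Finset.Icc (-m : ℤ) m, diag A (k - l) (j + l).toNat * diag B l j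
      = A (trunc (window m j) (B (basisVec j))) (j + k).toNat := by
    rw [trunc, map_sum, lp.coeFn_sum, Finset.sum_apply]
    refine Finset.sum_bij' (fun l _ => (j + l).toNat) (fun i _ => (i : ℤ) - j) ?_ ?_ ?_ ?_ ?_
    · intro l hl
      rw [Finset.mem_Icc] at hl
      rw [mem_window]
      omega
    · intro i hi
      rw [mem_window] at hi
      rw [Finset.mem_Icc]
      omega
    · intro l hl
      rw [Finset.mem_Icc] at hl
      omega
    · intro i hi
      omega
    · intro l hl
      rw [Finset.mem_Icc] at hl
      have h2 : (((j + l).toNat : ℤ) + (k - l)).toNat = (j + k).toNat := by omega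
      rw [map_smul, lp.coeFn_smul, Pi.smul_apply, smul_eq_mul, diag, diag, h2, mul_comm]
  beta_reduce
  rw [h1, dist_eq_norm, diag, mul_apply_eq_comp, ← Pi.sub_apply, ← lp.coeFn_sub, ← map_sub]
  refine (norm_coord_le _ _).trans ((A.le_opNorm _).trans
    ((mul_le_mul_of_nonneg_left (hm j) (norm_nonneg _)).trans ?_))
  rw [mul_div_assoc', div_le_iff₀ (by positivity)]
  nlinarith [norm_nonneg A]

theorem HasAAPDiags.of_closure {S : Set (L2N →L[ℂ] L2N)}
    (hS : ∀ B ∈ S, HasAAPDiags B) {A : L2N →L[ℂ] L2N} (hA : A ∈ closure S) :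
    HasAAPDiags A := by
  refine fun k => .of_forall_dist_le fun ε hε => ?_
  obtain ⟨B, hB, hAB⟩ := Metric.mem_closure_iff.1 hA ε hε
  refine ⟨diag B k, hS B hB k, .of_forall fun j => ?_⟩
  rw [dist_eq_norm] at hAB ⊢
  exact (norm_coord_le ((A - B) (basisVec j)) _).trans ((norm_apply_basisVec_le _ j).trans hAB.le)

/-! ### The algebra generated by Toeplitz operators and almost periodic multiplications -/

/-- The operators with asymptotically almost periodic diagonals whose columns and rows are uniformly
concentrated near the main diagonal.  This is a closed `C*`-algebra. -/
def aapAlg : StarSubalgebra ℂ (L2N →L[ℂ] L2N) where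
  carrier := {A | HasUniformColumns A ∧ HasUniformColumns (star A) ∧ HasAAPDiags A}
  mul_mem' := by
    rintro A B ⟨h1, h2, h3⟩ ⟨h4, h5, h6⟩
    exact ⟨h1.mul h4, by rw [star_mul]; exact h5.mul h2, h3.mul h6 h4⟩
  add_mem' := by
    rintro A B ⟨h1, h2, h3⟩ ⟨h4, h5, h6⟩
    exact ⟨h1.add h4, by rw [star_add]; exact h2.add h5, h3.add h6⟩
  algebraMap_mem' c := ⟨hasUniformColumns_algebraMap c, by
    rw [← algebraMap_star_comm]; exact hasUniformColumns_algebraMap _, hasAAPDiags_algebraMap c⟩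
  star_mem' := by
    rintro A ⟨h1, h2, h3⟩
    exact ⟨h2, by rwa [star_star], h3.star⟩

theorem isClosed_aapAlg : IsClosed (aapAlg : Set (L2N →L[ℂ] L2N)) := by
  refine isClosed_of_closure_subset fun A hA => ⟨.of_closure (fun B hB => hB.1) hA, ?_,
    .of_closure (fun B hB => hB.2.2) hA⟩
  exact .of_closure (S := (aapAlg : Set (L2N →L[ℂ] L2N))) (fun B hB => hB.1)
    (map_mem_closure continuous_star hA fun B hB => star_mem hB)

theorem mulOp_apply (b : ℤ →ᵇ ℂ) (x : L2N) (n : ℕ) : mulOp b x n = b n * x n := rfl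

theorem mulOp_basisVec (b : ℤ →ᵇ ℂ) (j : ℕ) : mulOp b (basisVec j) = b j • basisVec j := by
  ext n
  rw [mulOp_apply, lp.coeFn_smul, Pi.smul_apply, smul_eq_mul]
  by_cases h : n = j
  · rw [h]
  · simp [basisVec, h]

theorem star_mulOp_basisVec (b : ℤ →ᵇ ℂ) (j : ℕ) :
    (star (mulOp b)) (basisVec j) = star (b j) • basisVec j := by
  ext n
  rw [star_apply_basisVec, mulOp_basisVec, lp.coeFn_smul, lp.coeFn_smul, Pi.smul_apply,
    Pi.smul_apply]
  by_cases h : n = j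
  · simp [h, basisVec]
  · simp [basisVec, h, Ne.symm h]

theorem mulOp_mem_aapAlg {b : ℤ →ᵇ ℂ} (hb : IsAP b) : mulOp b ∈ aapAlg := by
  have hcol : ∀ (A : L2N →L[ℂ] L2N) (c : ℕ → ℂ), (∀ j, A (basisVec j) = c j • basisVec j) →
      HasUniformColumns A := by
    refine fun A c hA ε hε => ⟨0, fun j => ⟨A (basisVec j), fun i hi => ?_, by simp [hε.le]⟩⟩
    have : i ≠ j := fun h => hi (mem_window.2 (by omega))
    rw [hA]
    simp [basisVec, this]
  refine ⟨hcol _ _ (mulOp_basisVec b), hcol _ _ (star_mulOp_basisVec b), fun k => ?_⟩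
  refine IsAAP.congr' (?_ : IsAAP fun n => if k = 0 then b n else 0)
    (eventually_atTop.2 ⟨k.natAbs, fun n hn => ?_⟩)
  · split_ifs
    · exact ⟨b, hb, by simp⟩
    · exact isAAP_const 0
  · have h : (n + k).toNat = n ↔ k = 0 := by omega
    rw [diag, mulOp_basisVec]
    simp [basisVec, Pi.single_apply, h]

/-- An operator with a Toeplitz matrix whose symbol is an `l²`-sequence has uniform columns. -/
theorem HasUniformColumns.of_toeplitz {A : L2N →L[ℂ] L2N} (c : L2Z)
    (hA : ∀ i j : ℕ, A (basisVec j) i = c ((i : ℤ) - j)) : HasUniformColumns A := by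
  intro ε hε
  have hsum := lp.hasSum_single (by norm_num : (2 : ℝ≥0∞) ≠ ∞) c
  obtain ⟨s, hs⟩ := ((Metric.tendsto_nhds.1 hsum) ε hε).exists
  refine ⟨s.sup Int.natAbs, fun j => ?_⟩
  have he : Function.Injective fun i : ℕ => (i : ℤ) - j := fun a b h => by simpa using h
  refine ⟨pullback he (∑ i ∈ s, lp.single 2 i (c i)), fun i hi => ?_, ?_⟩
  · show (∑ i ∈ s, lp.single 2 i (c i) : L2Z) ((i : ℤ) - j) = 0
    rw [lp.coeFn_sum, Finset.sum_apply]
    refine Finset.sum_eq_zero fun l hl => ?_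
    have hl' : l.natAbs ≤ s.sup Int.natAbs := Finset.le_sup (f := Int.natAbs) hl
    rw [mem_window] at hi
    have hne : (i : ℤ) - j ≠ l := by omega
    simp [hne]
  · have h1 : A (basisVec j) = pullback he c := lp.ext (funext fun i => hA i j)
    rw [h1, ← map_sub]
    refine (norm_comp_le he _).trans ?_
    rw [← dist_eq_norm, dist_comm]
    exact hs.le

theorem toeplitz_mem_aapAlg (a : Lp ℂ ∞ circMeasure) : toeplitz a ∈ aapAlg := by
  have h1 : ∀ i j : ℕ, toeplitz a (basisVec j) i = fourierCoeff (a : Circ → ℂ) ((i : ℤ) - j) :=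
    fun i j => toeplitz_entry a i j
  refine ⟨.of_toeplitz (laurent a (lp.single 2 0 (1 : ℂ))) fun i j => ?_,
    .of_toeplitz ((laurent a).adjoint (lp.single 2 0 (1 : ℂ))) fun i j => ?_, fun k => ?_⟩
  · rw [h1, laurent_entry, sub_zero]
  · have h2 : ∀ (x : L2Z) (k : ℤ), x k = inner ℂ (lp.single 2 k (1 : ℂ)) x := fun x k => by
      rw [lp.inner_single_left]; simp
    rw [star_apply_basisVec, h1, h2, ContinuousLinearMap.adjoint_inner_right, ← inner_conj_symm,
      ← h2, laurent_entry, zero_sub, neg_sub]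
    rfl
  · refine (isAAP_const (fourierCoeff (a : Circ → ℂ) k)).congr'
      (eventually_atTop.2 ⟨k.natAbs, fun n hn => ?_⟩)
    have h : (((n + k).toNat : ℕ) : ℤ) - n = k := by omega
    rw [diag, h1, h]

/-- In particular, the diagonals of all operators in `opAlg` are asymptotically almost periodic. -/
theorem opAlg_le_aapAlg : opAlg ≤ aapAlg := by
  refine StarSubalgebra.topologicalClosure_minimal (StarAlgebra.adjoin_le ?_) isClosed_aapAlg
  rintro _ (⟨a, rfl⟩ | ⟨b, hb, rfl⟩)
  · exact toeplitz_mem_aapAlg a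
  · exact mulOp_mem_aapAlg hb

theorem exists_isDap {A : L2N →L[ℂ] L2N} (hA : A ∈ opAlg) : ∃ f, IsDap A f := by
  obtain ⟨f, hf, h⟩ := (opAlg_le_aapAlg hA).2.2 0
  refine ⟨f, hf, h.congr fun n => ?_⟩
  rw [diag, mainDiag, add_zero, Int.toNat_natCast]
  rfl


/-! ### The strong limit as a homomorphism -/

theorem inner_extendOp_star {n : ℕ} (T : ImP n →L[ℂ] ImP n) (x y : L2N) :
    inner ℂ x (extendOp (star T) y) = inner ℂ (extendOp T x) y := by
  simp only [extendOp, inclusion, ContinuousLinearMap.comp_apply,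
    ContinuousLinearMap.star_eq_adjoint]
  rw [ContinuousLinearMap.adjoint_inner_right, ContinuousLinearMap.adjoint_inner_right,
    ContinuousLinearMap.adjoint_inner_left]

theorem W_star (A : seqAlg) : W (star A) = star (W A) := by
  refine ContinuousLinearMap.ext fun y => ext_inner_left ℂ fun x => ?_
  rw [ContinuousLinearMap.star_eq_adjoint, ContinuousLinearMap.adjoint_inner_right]
  have h1 := (tendsto_const_nhds (x := x)).inner (𝕜 := ℂ) (isStrongLimit_W (star A) y)
  have h2 := (isStrongLimit_W A x).inner (𝕜 := ℂ) (tendsto_const_nhds (x := y))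
  exact tendsto_nhds_unique h1 (h2.congr fun n => (inner_extendOp_star (A.1 n) x y).symm)

/-- The strong limit `W` as a `*`-homomorphism. -/
noncomputable def WHom : seqAlg →⋆ₐ[ℂ] (L2N →L[ℂ] L2N) where
  toFun := W
  map_one' := W_eq (by simpa using isStrongLimit_algebraMap 1)
  map_mul' A B := W_eq ((isStrongLimit_W A).mul (isStrongLimit_W B))
  map_zero' := W_eq (by simpa using isStrongLimit_algebraMap 0)
  map_add' A B := W_eq ((isStrongLimit_W A).add (isStrongLimit_W B))
  commutes' c := W_eq (isStrongLimit_algebraMap c)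
  map_star' := W_star

theorem norm_W_le (A : seqAlg) : ‖W A‖ ≤ ‖A‖ := NonUnitalStarAlgHom.norm_apply_le WHom A

theorem continuous_WHom : Continuous WHom :=
  AddMonoidHomClass.continuous_of_bound WHom 1 fun A => by
    rw [one_mul]; exact norm_W_le A

/-- The evaluation `(A_n) ↦ A_n` as a `*`-homomorphism. -/
noncomputable def evalHom (n : ℕ) : seqAlg →⋆ₐ[ℂ] (ImP (n + 1) →L[ℂ] ImP (n + 1)) where
  toFun A := A.1 n
  map_one' := rfl
  map_mul' _ _ := rfl
  map_zero' := rfl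
  map_add' _ _ := rfl
  commutes' _ := rfl
  map_star' _ := rfl

theorem continuous_evalHom (n : ℕ) : Continuous (evalHom n) :=
  AddMonoidHomClass.continuous_of_bound (evalHom n) 1 fun A => by
    rw [one_mul]; exact NonUnitalStarAlgHom.norm_apply_le (evalHom n) A

/-! ### Sequences with vanishing normalised Hilbert-Schmidt norm -/

/-- The square of the Hilbert-Schmidt norm. -/
noncomputable def hsSq {n : ℕ} (X : ImP n →L[ℂ] ImP n) : ℝ :=
  ∑ j, ‖X (EuclideanSpace.basisFun (Fin n) ℂ j)‖ ^ 2

theorem hsSq_nonneg {n : ℕ} (X : ImP n →L[ℂ] ImP n) : 0 ≤ hsSq X :=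
  Finset.sum_nonneg fun _ _ => sq_nonneg _

theorem hsSq_star {n : ℕ} (X : ImP n →L[ℂ] ImP n) : hsSq (star X) = hsSq X := by
  have h : ∀ Y : ImP n →L[ℂ] ImP n, hsSq Y = ∑ j, ∑ i,
      ‖(inner ℂ (EuclideanSpace.basisFun (Fin n) ℂ i)
        (Y (EuclideanSpace.basisFun (Fin n) ℂ j)) : ℂ)‖ ^ 2 := fun Y =>
    Finset.sum_congr rfl fun j _ =>
      ((EuclideanSpace.basisFun (Fin n) ℂ).sum_sq_norm_inner_right _).symm
  rw [h, h, Finset.sum_comm]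
  refine Finset.sum_congr rfl fun i _ => Finset.sum_congr rfl fun j _ => ?_
  rw [ContinuousLinearMap.star_eq_adjoint, ContinuousLinearMap.adjoint_inner_right,
    norm_inner_symm]

theorem hsSq_add_le {n : ℕ} (X Y : ImP n →L[ℂ] ImP n) :
    hsSq (X + Y) ≤ 2 * hsSq X + 2 * hsSq Y := by
  rw [hsSq, hsSq, hsSq, Finset.mul_sum, Finset.mul_sum, ← Finset.sum_add_distrib]
  refine Finset.sum_le_sum fun j _ => ?_
  rw [_root_.add_apply]
  have h := norm_add_le (X (EuclideanSpace.basisFun (Fin n) ℂ j))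
    (Y (EuclideanSpace.basisFun (Fin n) ℂ j))
  nlinarith [sq_nonneg (‖X (EuclideanSpace.basisFun (Fin n) ℂ j)‖
    - ‖Y (EuclideanSpace.basisFun (Fin n) ℂ j)‖), norm_nonneg
    (X (EuclideanSpace.basisFun (Fin n) ℂ j) + Y (EuclideanSpace.basisFun (Fin n) ℂ j))]

theorem hsSq_mul_le {n : ℕ} (X Y : ImP n →L[ℂ] ImP n) : hsSq (X * Y) ≤ ‖X‖ ^ 2 * hsSq Y := by
  rw [hsSq, hsSq, Finset.mul_sum]
  refine Finset.sum_le_sum fun j _ => ?_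
  rw [← mul_pow]
  exact pow_le_pow_left₀ (norm_nonneg _) (X.le_opNorm _) 2

theorem hsSq_le {n : ℕ} (X : ImP n →L[ℂ] ImP n) : hsSq X ≤ n * ‖X‖ ^ 2 := by
  refine (Finset.sum_le_card_nsmul _ _ (‖X‖ ^ 2) fun j _ => ?_).trans_eq (by simp)
  refine pow_le_pow_left₀ (norm_nonneg _) ?_ 2
  simpa using X.le_opNorm (EuclideanSpace.basisFun (Fin n) ℂ j)

/-- The Cauchy-Schwarz inequality for the Hilbert-Schmidt inner product with the identity. -/
theorem norm_trace_sq_le {n : ℕ} (X : ImP n →L[ℂ] ImP n) :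
    ‖(X : ImP n →ₗ[ℂ] ImP n).trace ℂ (ImP n)‖ ^ 2 ≤ n * hsSq X := by
  rw [LinearMap.trace_eq_sum_inner _ (EuclideanSpace.basisFun (Fin n) ℂ)]
  have h : ‖∑ j, (inner ℂ (EuclideanSpace.basisFun (Fin n) ℂ j)
      (X (EuclideanSpace.basisFun (Fin n) ℂ j)) : ℂ)‖
      ≤ ∑ j, ‖X (EuclideanSpace.basisFun (Fin n) ℂ j)‖ :=
    norm_sum_le_of_le _ fun j _ => (norm_inner_le_norm _ _).trans_eq (by simp)
  refine (pow_le_pow_left₀ (norm_nonneg _) h 2).trans ?_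
  simpa [hsSq] using sq_sum_le_card_mul_sum_sq (s := Finset.univ)
    (f := fun j => ‖X (EuclideanSpace.basisFun (Fin n) ℂ j)‖)

/-- `(X_n)` is small on average: `‖X_n‖₂² / n → 0` for the Hilbert-Schmidt norm `‖·‖₂`. -/
def IsHSNull (X : BddSeq) : Prop :=
  Tendsto (fun n : ℕ => hsSq (X n) / (n + 1 : ℕ)) atTop (𝓝 0)

theorem IsHSNull.add {X Y : BddSeq} (hX : IsHSNull X) (hY : IsHSNull Y) : IsHSNull (X + Y) := by
  have h := (hX.const_mul 2).add (hY.const_mul 2)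
  rw [mul_zero, add_zero] at h
  refine squeeze_zero (fun n => div_nonneg (hsSq_nonneg _) (Nat.cast_nonneg _)) (fun n => ?_) h
  rw [← mul_div_assoc, ← mul_div_assoc, ← add_div]
  exact div_le_div_of_nonneg_right (hsSq_add_le _ _) (Nat.cast_nonneg _)

theorem IsHSNull.star {X : BddSeq} (hX : IsHSNull X) : IsHSNull (star X) := by
  refine hX.congr fun n => ?_
  rw [BddSeq.star_apply, hsSq_star]

theorem IsHSNull.mul_left {X : BddSeq} (hX : IsHSNull X) (Y : BddSeq) : IsHSNull (Y * X) := by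
  have h := hX.const_mul (‖Y‖ ^ 2)
  rw [mul_zero] at h
  refine squeeze_zero (fun n => div_nonneg (hsSq_nonneg _) (Nat.cast_nonneg _)) (fun n => ?_) h
  rw [← mul_div_assoc]
  refine div_le_div_of_nonneg_right ((hsSq_mul_le _ _).trans ?_) (Nat.cast_nonneg _)
  exact mul_le_mul_of_nonneg_right (pow_le_pow_left₀ (norm_nonneg _) (Y.norm_apply_le n) 2)
    (hsSq_nonneg _)

theorem IsHSNull.mul_right {X : BddSeq} (hX : IsHSNull X) (Y : BddSeq) : IsHSNull (X * Y) := by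
  simpa using (hX.star.mul_left (Star.star Y)).star

theorem IsHSNull.of_closure {S : Set BddSeq} (hS : ∀ Y ∈ S, IsHSNull Y) {X : BddSeq}
    (hX : X ∈ closure S) : IsHSNull X := by
  refine Metric.tendsto_nhds.2 fun ε hε => ?_
  obtain ⟨Y, hY, hXY⟩ := Metric.mem_closure_iff.1 hX (min 1 (ε / 4)) (by positivity)
  filter_upwards [Metric.tendsto_nhds.1 (hS Y hY) (ε / 4) (by positivity)] with n hn
  rw [Real.dist_0_eq_abs, abs_of_nonneg (div_nonneg (hsSq_nonneg _) (Nat.cast_nonneg _)),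
    div_lt_iff₀ (by positivity)] at hn ⊢
  have h1 := hsSq_add_le ((X - Y) n) (Y n)
  rw [← BddSeq.add_apply, sub_add_cancel] at h1
  have h2 := hsSq_le ((X - Y) n)
  have h3 := (X - Y).norm_apply_le n
  rw [dist_eq_norm, lt_min_iff] at hXY
  have h4 : ‖(X - Y) n‖ ^ 2 ≤ ε / 4 := by nlinarith [norm_nonneg ((X - Y) n)]
  have h5 : ((n + 1 : ℕ) : ℝ) * ‖(X - Y) n‖ ^ 2 ≤ (n + 1 : ℕ) * (ε / 4) :=
    mul_le_mul_of_nonneg_left h4 (Nat.cast_nonneg _)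
  have h6 : (0 : ℝ) < (n + 1 : ℕ) := by positivity
  nlinarith

/-- The normalised traces of a sequence which is small on average converge to zero. -/
theorem IsHSNull.tendsto_trace {X : BddSeq} (hX : IsHSNull X) :
    Tendsto (fun n : ℕ => (X n : ImP (n + 1) →ₗ[ℂ] ImP (n + 1)).trace ℂ (ImP (n + 1))
      / (n + 1 : ℕ)) atTop (𝓝 0) := by
  have h := hX.sqrt
  rw [Real.sqrt_zero] at h
  refine squeeze_zero_norm (fun n => Real.le_sqrt_of_sq_le ?_) h
  rw [norm_div, Complex.norm_natCast, div_pow, div_le_div_iff₀ (by positivity) (by positivity)]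
  have := norm_trace_sq_le (X n)
  nlinarith [Nat.cast_nonneg (α := ℝ) (n + 1)]

/-! ### Finite sections -/

theorem inclusion_basisFun {n : ℕ} (j : Fin n) :
    inclusion n (EuclideanSpace.basisFun (Fin n) ℂ j) = basisVec j := by
  ext k
  rw [inclusion_apply]
  split_ifs with h
  · simp [basisVec, Pi.single_apply, Fin.ext_iff]
  · have : k ≠ j := fun hk => h (hk ▸ j.2)
    simp [basisVec, this]

theorem inclusion_firstEntries_eq_trunc (n : ℕ) (x : L2N) :
    inclusion n (firstEntries n x) = trunc (Finset.range n) x := by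
  ext k
  rw [inclusion_apply, trunc_apply]
  simp only [Finset.mem_range]
  rfl

theorem trace_finSection (n : ℕ) (T : L2N →L[ℂ] L2N) :
    (finSection n T : ImP n →ₗ[ℂ] ImP n).trace ℂ (ImP n)
      = ∑ j ∈ Finset.range n, mainDiag T j := by
  rw [LinearMap.trace_eq_sum_inner _ (EuclideanSpace.basisFun (Fin n) ℂ),
    ← Fin.sum_univ_eq_sum_range]
  refine Finset.sum_congr rfl fun j _ => ?_
  have h : finSection n T (EuclideanSpace.basisFun (Fin n) ℂ j)
      = firstEntries n (T (basisVec j)) := by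
    rw [← inclusion_basisFun]; rfl
  rw [ContinuousLinearMap.coe_coe, h, ← ContinuousLinearMap.adjoint_inner_left]
  change inner ℂ (inclusion n (EuclideanSpace.basisFun (Fin n) ℂ j)) _ = _
  rw [inclusion_basisFun, inner_basisVec]
  rfl

theorem norm_finSection_mul_sub_apply_le {n : ℕ} (A B : L2N →L[ℂ] L2N) (j : Fin n) :
    ‖(finSection n A * finSection n B - finSection n (A * B))
      (EuclideanSpace.basisFun (Fin n) ℂ j)‖
      ≤ ‖A‖ * ‖B (basisVec j) - trunc (Finset.range n) (B (basisVec j))‖ := by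
  have h : (finSection n A * finSection n B - finSection n (A * B))
      (EuclideanSpace.basisFun (Fin n) ℂ j)
      = - firstEntries n (A (B (basisVec j) - trunc (Finset.range n) (B (basisVec j)))) := by
    rw [map_sub, map_sub, neg_sub, ← inclusion_firstEntries_eq_trunc, ← inclusion_basisFun]
    rfl
  rw [h, norm_neg]
  refine ((firstEntries n).le_of_opNorm_le (norm_firstEntries_le n) _).trans ?_
  rw [one_mul]
  exact A.le_opNorm _

/-- Only the columns with index close to `n` of an operator with uniform columns contribute
essentially to `(I - P_n) B P_n`. -/
theorem HasUniformColumns.tendsto_average {B : L2N →L[ℂ] L2N} (hB : HasUniformColumns B) :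
    Tendsto (fun n : ℕ => (∑ j ∈ Finset.range n,
      ‖B (basisVec j) - trunc (Finset.range n) (B (basisVec j))‖ ^ 2) / n) atTop (𝓝 0) := by
  refine Metric.tendsto_nhds.2 fun ε hε => ?_
  -- column `j` has norm at most `√(ε / 2)` outside `{0, …, n - 1}` unless `j ≥ n - m`
  obtain ⟨m, hm⟩ := hB (Real.sqrt (ε / 2)) (by positivity)
  have hcol : ∀ n j : ℕ, j + m < n →
      ‖B (basisVec j) - trunc (Finset.range n) (B (basisVec j))‖ ^ 2 ≤ ε / 2 := by
    intro n j hj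
    obtain ⟨y, hy, h⟩ := hm j
    rw [← Real.sq_sqrt (show 0 ≤ ε / 2 by positivity)]
    refine pow_le_pow_left₀ (norm_nonneg _) ((norm_sub_trunc_le _ fun i hi => hy i ?_).trans h) 2
    rw [Finset.mem_range] at hi
    rw [mem_window]
    omega
  have hall : ∀ n j : ℕ,
      ‖B (basisVec j) - trunc (Finset.range n) (B (basisVec j))‖ ^ 2 ≤ ‖B‖ ^ 2 := fun n j =>
    pow_le_pow_left₀ (norm_nonneg _)
      ((norm_sub_trunc_le_norm _ _).trans (norm_apply_basisVec_le B j)) 2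
  have hsum : ∀ n, m ≤ n → ∑ j ∈ Finset.range n,
      ‖B (basisVec j) - trunc (Finset.range n) (B (basisVec j))‖ ^ 2
      ≤ n * (ε / 2) + m * ‖B‖ ^ 2 := by
    intro n hn
    obtain ⟨k, rfl⟩ := Nat.exists_eq_add_of_le' hn
    rw [Finset.sum_range_add]
    have h1 := Finset.sum_le_card_nsmul (Finset.range k) _ _ fun j hj =>
      hcol (k + m) j (by rw [Finset.mem_range] at hj; omega)
    have h2 := Finset.sum_le_card_nsmul (Finset.range m) _ _ fun j _ => hall (k + m) (k + j)
    rw [Finset.card_range, nsmul_eq_mul] at h1 h2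
    push_cast
    nlinarith
  obtain ⟨N, hN⟩ := exists_nat_gt (m * ‖B‖ ^ 2 / (ε / 2))
  filter_upwards [eventually_ge_atTop (m + N + 1)] with n hn
  have hn' : (N : ℝ) + 1 ≤ n := by exact_mod_cast (by omega : N + 1 ≤ n)
  have hN0 : (0 : ℝ) ≤ N := N.cast_nonneg
  rw [Real.dist_0_eq_abs, abs_of_nonneg (by positivity), div_lt_iff₀ (by linarith)]
  rw [div_lt_iff₀ (by positivity)] at hN
  have := hsum n (by omega)
  nlinarith

/-- The finite sections of a product are, on average, the products of the finite sections. -/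
theorem isHSNull_finSections_mul_sub (A : L2N →L[ℂ] L2N) {B : L2N →L[ℂ] L2N}
    (hB : HasUniformColumns B) :
    IsHSNull (finSectionsBdd A * finSectionsBdd B - finSectionsBdd (A * B)) := by
  have h := ((tendsto_add_atTop_iff_nat 1).2 hB.tendsto_average).const_mul (‖A‖ ^ 2)
  rw [mul_zero] at h
  refine squeeze_zero (fun n => div_nonneg (hsSq_nonneg _) (Nat.cast_nonneg _)) (fun n => ?_) h
  rw [← mul_div_assoc]
  refine div_le_div_of_nonneg_right ?_ (Nat.cast_nonneg _)
  rw [← Fin.sum_univ_eq_sum_range (fun j => ‖B (basisVec j)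
    - trunc (Finset.range (n + 1)) (B (basisVec j))‖ ^ 2), Finset.mul_sum]
  refine Finset.sum_le_sum fun j _ => ?_
  rw [← mul_pow]
  exact pow_le_pow_left₀ (norm_nonneg _) (norm_finSection_mul_sub_apply_le A B j) 2

theorem finSection_sub (n : ℕ) (S T : L2N →L[ℂ] L2N) :
    finSection n (S - T) = finSection n S - finSection n T := by
  ext1 x; simp [finSection]

theorem finSection_add (n : ℕ) (S T : L2N →L[ℂ] L2N) :
    finSection n (S + T) = finSection n S + finSection n T := by
  ext1 x; simp [finSection]

theorem finSectionsBdd_add (S T : L2N →L[ℂ] L2N) :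
    finSectionsBdd (S + T) = finSectionsBdd S + finSectionsBdd T :=
  BddSeq.ext fun n => finSection_add (n + 1) S T

theorem finSectionsBdd_sub (S T : L2N →L[ℂ] L2N) :
    finSectionsBdd (S - T) = finSectionsBdd S - finSectionsBdd T :=
  BddSeq.ext fun n => finSection_sub (n + 1) S T

theorem finSectionsBdd_star (T : L2N →L[ℂ] L2N) :
    finSectionsBdd (star T) = star (finSectionsBdd T) :=
  BddSeq.ext fun n => (star_finSection (n + 1) T).symm

theorem finSectionsBdd_algebraMap (c : ℂ) :
    finSectionsBdd (algebraMap ℂ _ c) = algebraMap ℂ BddSeq c := by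
  refine BddSeq.ext fun n => ContinuousLinearMap.ext fun x => ?_
  show firstEntries (n + 1) (algebraMap ℂ (L2N →L[ℂ] L2N) c (inclusion (n + 1) x)) = _
  rw [BddSeq.algebraMap_apply]
  simp [Algebra.algebraMap_eq_smul_one, firstEntries_inclusion]

theorem norm_finSectionsBdd_le (T : L2N →L[ℂ] L2N) : ‖finSectionsBdd T‖ ≤ ‖T‖ := by
  rw [BddSeq.norm_eq_iSup]
  exact ciSup_le fun n => norm_finSection_le (n + 1) T

theorem continuous_finSectionsBdd : Continuous finSectionsBdd := by
  refine (LipschitzWith.of_dist_le_mul (K := 1) fun S T => ?_).continuous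
  rw [dist_eq_norm, dist_eq_norm, ← finSectionsBdd_sub, NNReal.coe_one, one_mul]
  exact norm_finSectionsBdd_le _

theorem isHSNull_zero : IsHSNull 0 := by
  have h : ∀ n, hsSq ((0 : BddSeq) n) = 0 := fun n => by simp [hsSq, BddSeq.zero_apply]
  simp [IsHSNull, h]

/-- The sequences `𝐀` whose strong limit belongs to the operator algebra and which coincide on
average with the finite sections of their strong limit. -/
noncomputable def averageAlg : StarSubalgebra ℂ seqAlg where
  carrier := {A | W A ∈ opAlg ∧ IsHSNull (A.1 - finSectionsBdd (W A))}
  mul_mem' := by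
    rintro A B ⟨h1, h2⟩ ⟨h3, h4⟩
    have hW : W (A * B) = W A * W B := map_mul WHom A B
    refine ⟨by rw [hW]; exact mul_mem h1 h3, ?_⟩
    have h : (A * B).1 - finSectionsBdd (W (A * B)) = (A.1 - finSectionsBdd (W A)) * B.1
        + finSectionsBdd (W A) * (B.1 - finSectionsBdd (W B))
        + (finSectionsBdd (W A) * finSectionsBdd (W B) - finSectionsBdd (W A * W B)) := by
      rw [hW, show (A * B).1 = A.1 * B.1 from rfl, sub_mul, mul_sub]
      abel
    rw [h]
    exact ((h2.mul_right _).add (h4.mul_left _)).add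
      (isHSNull_finSections_mul_sub _ (opAlg_le_aapAlg h3).1)
  add_mem' := by
    rintro A B ⟨h1, h2⟩ ⟨h3, h4⟩
    have hW : W (A + B) = W A + W B := map_add WHom A B
    refine ⟨by rw [hW]; exact add_mem h1 h3, ?_⟩
    rw [hW, finSectionsBdd_add, show (A + B).1 = A.1 + B.1 from rfl, add_sub_add_comm]
    exact h2.add h4
  algebraMap_mem' c := by
    have hW : W (algebraMap ℂ seqAlg c) = algebraMap ℂ _ c := AlgHomClass.commutes WHom c
    refine ⟨by rw [hW]; exact algebraMap_mem _ c, ?_⟩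
    rw [hW, finSectionsBdd_algebraMap,
      show (algebraMap ℂ seqAlg c).1 = algebraMap ℂ BddSeq c from rfl, sub_self]
    exact isHSNull_zero
  star_mem' := by
    rintro A ⟨h1, h2⟩
    have hW : W (star A) = star (W A) := W_star A
    refine ⟨by rw [hW]; exact star_mem h1, ?_⟩
    rw [hW, finSectionsBdd_star, show (star A).1 = star A.1 from rfl, ← star_sub]
    exact h2.star

theorem isClosed_averageAlg : IsClosed (averageAlg : Set seqAlg) := by
  refine isClosed_of_closure_subset fun A hA => ⟨?_, ?_⟩
  · have h := map_mem_closure (t := (opAlg : Set (L2N →L[ℂ] L2N))) continuous_WHom hA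
      fun B hB => hB.1
    exact (StarSubalgebra.isClosed_topologicalClosure _).closure_subset h
  · have hc : Continuous fun B : seqAlg => B.1 - finSectionsBdd (W B) :=
      continuous_subtype_val.sub (continuous_finSectionsBdd.comp continuous_WHom)
    have h := map_mem_closure (t := {X | IsHSNull X}) hc hA fun B hB => hB.2
    exact .of_closure (fun _ h => h) h

/-- Every sequence in `sectionsAlg` is, on average, the sequence of finite sections of its strong
limit. -/
theorem sectionsAlg_le_averageAlg : sectionsAlg ≤ averageAlg := by
  refine StarSubalgebra.topologicalClosure_minimal (StarAlgebra.adjoin_le ?_) isClosed_averageAlg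
  rintro _ ⟨T, hT, rfl⟩
  refine ⟨by rw [W_finSections]; exact hT, ?_⟩
  rw [W_finSections, show (finSections T).1 = finSectionsBdd T from rfl, sub_self]
  exact isHSNull_zero


/-! ### Functional calculus, eigenvectors and singular values -/

theorem mem_spectrum_of_apply_eq_smul {n : ℕ} {T : ImP n →L[ℂ] ImP n} {c : ℂ} {x : ImP n}
    (hx : x ≠ 0) (h : T x = c • x) : c ∈ spectrum ℂ T := by
  intro hu
  obtain ⟨S, hS⟩ := hu.exists_left_inv
  have h1 : (S * (algebraMap ℂ (ImP n →L[ℂ] ImP n) c - T)) x = x := by rw [hS]; rfl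
  rw [mul_apply_eq_comp, _root_.sub_apply, Algebra.algebraMap_eq_smul_one, h] at h1
  simp at h1
  exact hx h1.symm

theorem finite_spectrum {n : ℕ} (T : ImP n →L[ℂ] ImP n) : (spectrum ℂ T).Finite := by
  have h := AlgEquiv.spectrum_eq (Module.End.toContinuousLinearMap (𝕜 := ℂ) (ImP n)).symm T
  rw [← h]
  exact Module.End.finite_spectrum _

theorem aeval_apply_of_apply_eq_smul {n : ℕ} {T : ImP n →L[ℂ] ImP n} {c : ℂ} {x : ImP n}
    (h : T x = c • x) (p : Polynomial ℂ) : Polynomial.aeval T p x = p.eval c • x := by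
  induction p using Polynomial.induction_on' with
  | add p q hp hq => rw [map_add, _root_.add_apply, hp, hq, Polynomial.eval_add, add_smul]
  | monomial k a =>
    have hk : (T ^ k) x = c ^ k • x := by
      induction k with
      | zero => simp
      | succ k ih => rw [pow_succ, mul_apply_eq_comp, h, map_smul, ih, smul_smul, pow_succ']
    rw [Polynomial.aeval_monomial, mul_apply_eq_comp, hk, Polynomial.eval_monomial,
      Algebra.algebraMap_eq_smul_one, smul_apply, one_apply_eq_self, smul_smul]

/-- The continuous functional calculus acts on eigenvectors as expected. -/
theorem cfc_apply_of_apply_eq_smul {n : ℕ} {T : ImP n →L[ℂ] ImP n} (hT : IsStarNormal T) {c : ℂ}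
    {x : ImP n} (h : T x = c • x) (f : ℂ → ℂ) : cfc f T x = f c • x := by
  by_cases hx : x = 0
  · simp [hx]
  -- on the finite spectrum, `f` coincides with an interpolation polynomial
  obtain ⟨p, hp⟩ : ∃ p : Polynomial ℂ, ∀ z ∈ spectrum ℂ T, f z = p.eval z :=
    ⟨Lagrange.interpolate (finite_spectrum T).toFinset id f, fun z hz =>
      (Lagrange.eval_interpolate_at_node f (Set.injOn_id _)
        ((finite_spectrum T).mem_toFinset.2 hz)).symm⟩
  rw [cfc_congr hp, cfc_polynomial p T hT, aeval_apply_of_apply_eq_smul h,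
    hp c (mem_spectrum_of_apply_eq_smul hx h)]

/-- The singular values of `T` are the eigenvalues of `(T^* T)^{1/2}`, with the same
multiplicities. -/
theorem exists_orthonormalBasis_singularValues {n : ℕ} (T : ImP n →L[ℂ] ImP n) :
    ∃ e : OrthonormalBasis (Fin n) ℂ (ImP n), ∀ i : Fin n, cfc Real.sqrt (star T * T) (e i)
      = (((T : ImP n →ₗ[ℂ] ImP n).singularValues i : ℝ) : ℂ) • e i := by
  have hn : Module.finrank ℂ (ImP n) = n := by simp
  set S := (T : ImP n →ₗ[ℂ] ImP n).isSymmetric_adjoint_comp_self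
  refine ⟨S.eigenvectorBasis hn, fun i => ?_⟩
  have h1 : (star T * T) (S.eigenvectorBasis hn i)
      = ((S.eigenvalues hn i : ℝ) : ℂ) • S.eigenvectorBasis hn i :=
    S.apply_eigenvectorBasis hn i
  have hsa : IsSelfAdjoint (star T * T) := .star_mul_self T
  rw [cfc_real_eq_complex, cfc_apply_of_apply_eq_smul hsa.isStarNormal h1,
    LinearMap.singularValues_fin _ hn, Complex.ofReal_re]

/-- The trace of `f((T^* T)^{1/2})` is the sum of the values of `f` at the singular values. -/
theorem trace_cfc_sqrt {n : ℕ} (T : ImP n →L[ℂ] ImP n) (f : ℂ → ℂ) :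
    ((cfc f (cfc Real.sqrt (star T * T)) : ImP n →L[ℂ] ImP n) : ImP n →ₗ[ℂ] ImP n).trace ℂ (ImP n)
      = ∑ i ∈ Finset.range n, f ((T : ImP n →ₗ[ℂ] ImP n).singularValues i : ℝ) := by
  obtain ⟨e, he⟩ := exists_orthonormalBasis_singularValues T
  have hsa : IsSelfAdjoint (cfc Real.sqrt (star T * T)) := cfc_predicate _ _
  rw [LinearMap.trace_eq_sum_inner _ e, ← Fin.sum_univ_eq_sum_range
    (fun i => f ((T : ImP n →ₗ[ℂ] ImP n).singularValues i : ℝ))]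
  refine Finset.sum_congr rfl fun i _ => ?_
  rw [ContinuousLinearMap.coe_coe, cfc_apply_of_apply_eq_smul hsa.isStarNormal (he i),
    inner_smul_right, inner_self_eq_norm_sq_to_K, e.norm_eq_one]
  simp

/-! ### The stability spectrum -/

/-- Near a point outside the stability spectrum there are no eigenvalues of `A_n` for large `n`. -/
theorem exists_le_dist_of_notMem_stabilitySpectrum {A : seqAlg} {c : ℂ}
    (hc : c ∉ stabilitySpectrum A) : ∃ δ > 0, ∀ᶠ n in atTop, ∀ (z : ℂ) (x : ImP (n + 1)),
      x ≠ 0 → A.1 n x = z • x → δ ≤ dist z c := by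
  rw [stabilitySpectrum, spectrum.notMem_iff] at hc
  obtain ⟨q, hq⟩ := hc.exists_left_inv
  obtain ⟨C, rfl⟩ := Ideal.Quotient.mk_surjective q
  have hmem : C * (algebraMap ℂ seqAlg c - A) - 1 ∈ nullIdeal := by
    rw [← Ideal.Quotient.eq, map_mul, map_sub, map_one]
    exact hq
  refine ⟨1 / (2 * (‖C.1‖ + 1)), by positivity, ?_⟩
  filter_upwards [(show Tendsto _ _ _ from hmem).eventually (gt_mem_nhds (show (0 : ℝ) < 1 / 2 by
    norm_num))] with n hn z x hx hz
  have h1 : (C * (algebraMap ℂ seqAlg c - A) - 1).1 n x = (c - z) • C.1 n x - x := by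
    have h2 : (C * (algebraMap ℂ seqAlg c - A) - 1).1 n x
        = C.1 n (algebraMap ℂ (ImP (n + 1) →L[ℂ] ImP (n + 1)) c x - A.1 n x) - x := rfl
    rw [h2, hz, Algebra.algebraMap_eq_smul_one, ← map_smul, sub_smul]
    rfl
  have h3 := ((C * (algebraMap ℂ seqAlg c - A) - 1).1 n).le_of_opNorm_le hn.le x
  rw [h1] at h3
  have h4 : ‖x‖ ≤ ‖(c - z) • C.1 n x‖ + ‖(c - z) • C.1 n x - x‖ := by
    simpa using norm_sub_le ((c - z) • C.1 n x) ((c - z) • C.1 n x - x)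
  have h5 : ‖(c - z) • C.1 n x‖ ≤ dist z c * ((‖C.1‖ + 1) * ‖x‖) := by
    rw [norm_smul, dist_comm, dist_eq_norm]
    refine mul_le_mul_of_nonneg_left (((C.1 n).le_opNorm x).trans ?_) (norm_nonneg _)
    exact mul_le_mul_of_nonneg_right ((C.1.norm_apply_le n).trans (by linarith)) (norm_nonneg _)
  have hx' : 0 < ‖x‖ := norm_pos_iff.2 hx
  have h6 : 1 / 2 * ‖x‖ ≤ dist z c * (‖C.1‖ + 1) * ‖x‖ := by linarith
  have h7 := le_of_mul_le_mul_right h6 hx'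
  rw [div_le_iff₀ (by positivity)]
  linarith

/-- If the stability spectrum is contained in the open set `U`, then for large `n` the real
eigenvalues of `A_n` belong to a fixed compact subset of `U`. -/
theorem exists_isCompact_eigenvalues {A : seqAlg} {U : Set ℝ} (hU : IsOpen U)
    (hσ : stabilitySpectrum A ⊆ Complex.ofReal '' U) :
    ∃ K ⊆ U, IsCompact K ∧ ∀ᶠ n in atTop, ∀ (t : ℝ) (x : ImP (n + 1)), x ≠ 0 →
      A.1 n x = (t : ℂ) • x → t ∈ K := by
  have hloc : ∃ K ⊆ U, IsCompact K ∧ ∀ᶠ n in atTop, ∀ (t : ℝ) (x : ImP (n + 1)), x ≠ 0 →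
      A.1 n x = (t : ℂ) • x → t ∈ Set.Icc (-‖A.1‖) ‖A.1‖ → t ∈ K := by
    refine IsCompact.induction_on (isCompact_Icc (a := -‖A.1‖) (b := ‖A.1‖))
      (p := fun s => ∃ K ⊆ U, IsCompact K ∧ ∀ᶠ n in atTop, ∀ (t : ℝ) (x : ImP (n + 1)), x ≠ 0 →
        A.1 n x = (t : ℂ) • x → t ∈ s → t ∈ K) ?_ ?_ ?_ ?_
    · exact ⟨∅, Set.empty_subset _, isCompact_empty, by simp⟩
    · rintro s s' hs ⟨K, hK, hKc, h⟩
      exact ⟨K, hK, hKc, h.mono fun n hn t x hx ht hts => hn t x hx ht (hs hts)⟩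
    · rintro s s' ⟨K, hK, hKc, h⟩ ⟨K', hK', hKc', h'⟩
      refine ⟨K ∪ K', Set.union_subset hK hK', hKc.union hKc', ?_⟩
      filter_upwards [h, h'] with n hn hn' t x hx ht hts
      exact hts.imp (hn t x hx ht) (hn' t x hx ht)
    · intro c _
      by_cases hc : c ∈ U
      · obtain ⟨K, hK, hcK, hKU⟩ := exists_compact_subset hU hc
        exact ⟨K, nhdsWithin_le_nhds (mem_interior_iff_mem_nhds.1 hcK), K, hKU, hK,
          .of_forall fun n t x _ _ ht => ht⟩
      · have hc' : (c : ℂ) ∉ stabilitySpectrum A := fun h => by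
          obtain ⟨t, ht, htc⟩ := hσ h
          exact hc (Complex.ofReal_injective htc ▸ ht)
        obtain ⟨δ, hδ, h⟩ := exists_le_dist_of_notMem_stabilitySpectrum hc'
        refine ⟨Metric.ball c δ, nhdsWithin_le_nhds (Metric.ball_mem_nhds c hδ), ∅,
          Set.empty_subset _, isCompact_empty, h.mono fun n hn t x hx ht htc => ?_⟩
        have h1 := hn t x hx ht
        rw [Complex.dist_of_im_eq (by simp), Complex.ofReal_re, Complex.ofReal_re] at h1
        exact absurd (Metric.mem_ball.1 htc) (not_lt.2 h1)
  obtain ⟨K, hK, hKc, h⟩ := hloc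
  refine ⟨K, hK, hKc, h.mono fun n hn t x hx ht => hn t x hx ht ?_⟩
  have h1 := (A.1 n).le_of_opNorm_le (A.1.norm_apply_le n) x
  rw [ht, norm_smul, Complex.norm_real] at h1
  exact abs_le.1 (le_of_mul_le_mul_right h1 (norm_pos_iff.2 hx))

/-- `W` is a homomorphism which vanishes on `nullIdeal`, so it factors through the quotient. -/
theorem spectrum_W_subset (A : seqAlg) : spectrum ℂ (W A) ⊆ stabilitySpectrum A := by
  intro c hc hu
  refine hc ?_
  have hker : ∀ G ∈ nullIdeal, WHom G = 0 := by
    intro G hG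
    refine W_eq fun x => squeeze_zero_norm (fun n => ?_)
      (by simpa using (show Tendsto _ _ _ from hG).mul_const ‖x‖)
    exact (extendOp (G.1 n)).le_of_opNorm_le (norm_extendOp_le _) x
  have h := hu.map (Ideal.Quotient.lift nullIdeal (WHom : seqAlg →+* (L2N →L[ℂ] L2N)) hker)
  have h1 : algebraMap ℂ (seqAlg ⧸ nullIdeal) c - Ideal.Quotient.mk nullIdeal A
      = Ideal.Quotient.mk nullIdeal (algebraMap ℂ seqAlg c - A) := by
    rw [map_sub]; rfl
  rw [h1] at h
  have h2 : WHom (algebraMap ℂ seqAlg c - A) = algebraMap ℂ (L2N →L[ℂ] L2N) c - W A := by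
    rw [map_sub, AlgHomClass.commutes]; rfl
  rw [spectrum.mem_resolventSet_iff, ← h2]
  exact h

/-! ### Averages of singular values -/

theorem absSeq_isSelfAdjoint (A : seqAlg) : IsSelfAdjoint (absSeq A) := cfc_predicate _ _

theorem absSeq_apply (A : seqAlg) (n : ℕ) :
    (absSeq A).1 n = cfc Real.sqrt (star (A.1 n) * A.1 n) :=
  StarAlgHom.map_cfc (S := ℂ) (evalHom n) Real.sqrt (star A * A)
    (hf := Real.continuous_sqrt.continuousOn) (hφ := continuous_evalHom n)
    (ha := .star_mul_self A) (hφa := .star_mul_self (A.1 n))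

theorem absSeq_mem {A : seqAlg} (hA : A ∈ sectionsAlg) : absSeq A ∈ sectionsAlg :=
  have : IsClosed (sectionsAlg : Set seqAlg) := StarSubalgebra.isClosed_topologicalClosure _
  cfc_mem Real.sqrt (mul_mem (star_mem hA) hA)

/-- A null sequence does not contribute to the arithmetic means. -/
theorem tendsto_average_mainDiag {T : L2N →L[ℂ] L2N} {f : ℤ →ᵇ ℂ} (hf : IsDap T f) :
    Tendsto (fun n : ℕ => (∑ j ∈ Finset.range n, mainDiag T j) / n) atTop (𝓝 (meanValue f)) := by
  have h := hf.2.cesaro_smul.add hf.1.tendsto_means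
  rw [zero_add] at h
  refine h.congr fun n => ?_
  rw [means, Finset.sum_sub_distrib, Complex.real_smul]
  push_cast
  ring

end SzegoAP

open SzegoAP

theorem theorem5p6 (A : seqAlg) (hA : A ∈ sectionsAlg)
    (U : Set ℝ) (hU : IsOpen U) (hσ : stabilitySpectrum (absSeq A) ⊆ Complex.ofReal '' U)
    (g : ℝ → ℂ) (hg : ContinuousOn g U) :
    (IsSelfAdjoint (W (absSeq A)) ∧ spectrum ℂ (W (absSeq A)) ⊆ Complex.ofReal '' U) ∧
    applyFun g (W (absSeq A)) ∈ opAlg ∧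
    IsDap (applyFun g (W (absSeq A))) (Dap (applyFun g (W (absSeq A)))) ∧
    Tendsto (means (Dap (applyFun g (W (absSeq A))))) atTop
      (𝓝 (meanValue (Dap (applyFun g (W (absSeq A)))))) ∧
    Tendsto (fun n => singularAverage g (A.1 n)) atTop
      (𝓝 (meanValue (Dap (applyFun g (W (absSeq A)))))) := by
  set B := absSeq A with hB
  have hBsa : IsSelfAdjoint B := absSeq_isSelfAdjoint A
  have hWsa : IsSelfAdjoint (W B) := hBsa.map WHom
  have hWσ : spectrum ℂ (W B) ⊆ Complex.ofReal '' U := (spectrum_W_subset B).trans hσ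
  obtain ⟨K, hKU, hK, hev⟩ := exists_isCompact_eigenvalues hU hσ
  -- `g` is replaced by a function `f` on the whole line which coincides with `g` on the spectrum of
  -- the strong limit and at the singular values of `A_n` for large `n`
  set L : Set ℝ := K ∪ Complex.re '' spectrum ℂ (W B)
  have hL : IsCompact L := hK.union ((spectrum.isCompact _).image Complex.continuous_re)
  have hLU : L ⊆ U := by
    refine Set.union_subset hKU ?_
    rintro _ ⟨z, hz, rfl⟩
    obtain ⟨t, ht, rfl⟩ := hWσ hz
    simpa using ht
  obtain ⟨f, hf⟩ := ContinuousMap.exists_restrict_eq hL.isClosed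
    (⟨L.domRestrict g, (hg.mono hLU).domRestrict⟩ : C(L, ℂ))
  have hfg : ∀ t ∈ L, f t = g t := fun t ht => DFunLike.congr_fun hf ⟨t, ht⟩
  have hfc : Continuous fun z : ℂ => f z.re := f.continuous.comp Complex.continuous_re
  set C : seqAlg := cfc (fun z : ℂ => f z.re) B with hC
  have hCmem : C ∈ sectionsAlg :=
    have : IsClosed (sectionsAlg : Set seqAlg) := StarSubalgebra.isClosed_topologicalClosure _
    cfc_mem _ (absSeq_mem hA)
  have hWC : W C = applyFun g (W B) := by
    have h1 : W C = cfc (fun z : ℂ => f z.re) (W B) :=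
      StarAlgHom.map_cfc (S := ℂ) WHom (fun z : ℂ => f z.re) B (hf := hfc.continuousOn)
        (hφ := continuous_WHom) (ha := hBsa.isStarNormal) (hφa := hWsa.isStarNormal)
    rw [h1]
    exact cfc_congr fun z hz => hfg _ (Or.inr ⟨z, hz, rfl⟩)
  obtain ⟨hmem, hnull⟩ := sectionsAlg_le_averageAlg hCmem
  rw [hWC] at hmem hnull
  have hdap : IsDap (applyFun g (W B)) (Dap (applyFun g (W B))) := by
    obtain ⟨d, hd⟩ := exists_isDap hmem
    rwa [Dap_eq hd]
  refine ⟨⟨hWsa, hWσ⟩, hmem, hdap, hdap.1.tendsto_means, ?_⟩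
  have hlim := hnull.tendsto_trace.add
    ((tendsto_add_atTop_iff_nat 1).2 (tendsto_average_mainDiag hdap))
  rw [zero_add] at hlim
  refine hlim.congr' ?_
  filter_upwards [hev] with n hn
  have hBn : B.1 n = cfc Real.sqrt (star (A.1 n) * A.1 n) := absSeq_apply A n
  have hCn : C.1 n = cfc (fun z : ℂ => f z.re) (cfc Real.sqrt (star (A.1 n) * A.1 n)) := by
    rw [← hBn]
    exact StarAlgHom.map_cfc (S := ℂ) (evalHom n) (fun z : ℂ => f z.re) B
      (hf := hfc.continuousOn) (hφ := continuous_evalHom n) (ha := hBsa.isStarNormal)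
      (hφa := (hBsa.map (evalHom n)).isStarNormal)
  have htr : ((C.1 - finSectionsBdd (applyFun g (W B))) n : ImP (n + 1) →ₗ[ℂ] ImP (n + 1)).trace ℂ
      (ImP (n + 1)) = ∑ i ∈ Finset.range (n + 1),
        f ((A.1 n : ImP (n + 1) →ₗ[ℂ] ImP (n + 1)).singularValues i)
        - ∑ j ∈ Finset.range (n + 1), mainDiag (applyFun g (W B)) j := by
    rw [← trace_finSection, BddSeq.sub_apply, ContinuousLinearMap.toLinearMap_sub,
      map_sub, hCn, trace_cfc_sqrt]
    rfl
  rw [htr, singularAverage, ← add_div, sub_add_cancel]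
  congr 1
  obtain ⟨e, he⟩ := exists_orthonormalBasis_singularValues (A.1 n)
  refine Finset.sum_congr rfl fun i hi => hfg _ (Or.inl ?_)
  rw [← hBn] at he
  exact hn _ _ (e.orthonormal.ne_zero _) (he ⟨i, Finset.mem_range.1 hi⟩)
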